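/- Throughout, a hypergraph has a finite vertex set and a set of edges, which are subsets of the vertex set; it is $r$-uniform if every edge has exactly $r$ vertices. A cycle of length $\ell\ge 2$ is a sequence $v_1e_1v_2e_2\cdots v_\ell e_\ell v_1$ with distinct vertices $v_i$ and distinct edges $e_i$ such that $v_i,v_{i+1}\in e_i$ (indices modulo $\ell$). An $r$-uniform supertree is a connected $r$-uniform hypergraph, with at least one vertex, without cycles. For an $r$-uniform hypergraph $K$ with $n$ vertices let $m(K,k)$ be the number of sets of $k$ pairwise disjoint edges of $K$. The matching polynomial is $\varphi(K,x)=\sum_{k\ge 0}(-1)^k m(K,k)\,x^{n-kr}$, and the matching energy $ME(K)$ is the sum of the absolute values of all complex roots of $\varphi(K,x)$, counted with multiplicity. The spectral radius $\rho(K)$ is the maximum modulus of the eigenvalues of the adjacency tensor of $K$, that is, the tensor of order $r$ with entry $a_{i_1\cdots i_r}=\frac1{(r-1)!}$ if $\{i_1,\dots,i_r\}$ is an edge of $K$ and $0$ otherwise; here $\lambda\in\mathbb C$ is an eigenvalue if there is a nonzero complex vector $x$, indexed by the vertices, with $\sum_{i_2,\dots,i_r}a_{i i_2\cdots i_r}x_{i_2}\cdots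 x_{i_r}=\lambda x_i^{r-1}$ for every vertex $i$. Finally, $K-u$ is obtained from $K$ by deleting the vertex $u$ and all edges containing it. **Theorem.** Let $r\ge 3$, let $G$ and $H$ be $r$-uniform supertrees with the same number of vertices, let $u$ be a vertex of $G$ and $v$ a vertex of $H$, and let $m$ be a positive integer. For $0\le k\le m$ let $H_v^{m-k}\cdot G_u^{k}$ be the hypergraph obtained from the disjoint union of $k$ copies of $G$ and $m-k$ copies of $H$ by identifying all the copies of $u$ and all the copies of $v$ to one vertex. If $\varphi(G,x)=\varphi(H,x)$ and $\varphi(G-u,x)=\varphi(H-v,x)$, then (i) the hypergraphs $H_v^{m-k}\cdot G_u^{k}$, $k=0,1,\dots,m$, all have the same spectral radius; (ii) the hypergraphs $H_v^{m-k}\cdot G_u^{k}$, $k=0,1,\dots,m$, all have the same matching energy. -/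

import Mathlib

noncomputable section

namespace Hypergraph

/-! ### Uniform supertrees -/

/-- Every edge has exactly `r` vertices. -/
def IsUniform {α : Type*} (K : Hypergraph α) (r : ℕ) : Prop :=
  ∀ e ∈ K.edgeSet, e.ncard = r

/-- There is a vertex, and any two vertices are joined by a walk, each step of which stays inside
an edge. -/
def IsConnected {α : Type*} (K : Hypergraph α) : Prop :=
  K.vertexSet.Nonempty ∧
    ∀ x ∈ K.vertexSet, ∀ y ∈ K.vertexSet, Relation.ReflTransGen K.Adj x y

/-- There is a cycle `v₀ e₀ v₁ e₁ … v_{l-1} e_{l-1} v₀` of some length `l = n + 2 ≥ 2`, with distinct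
vertices and distinct edges. The successor `i + 1` is taken in `Fin (n + 2)`, that is, modulo
`n + 2`. -/
def HasCycle {α : Type*} (K : Hypergraph α) : Prop :=
  ∃ (n : ℕ) (v : Fin (n + 2) → α) (e : Fin (n + 2) → Set α),
    Function.Injective v ∧ Function.Injective e ∧
      ∀ i, e i ∈ K.edgeSet ∧ v i ∈ e i ∧ v (i + 1) ∈ e i

/-- An `r`-uniform supertree: a finite, `r`-uniform, connected hypergraph without cycles. -/
structure IsSupertree {α : Type*} (K : Hypergraph α) (r : ℕ) : Prop where
  finite : K.vertexSet.Finite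
  uniform : K.IsUniform r
  connected : K.IsConnected
  acyclic : ¬ K.HasCycle

/-- The hypergraph `K - u`: delete the vertex `u` and all the edges that contain it. -/
def deleteVertex {α : Type*} (K : Hypergraph α) (u : α) : Hypergraph α where
  vertexSet := K.vertexSet \ {u}
  edgeSet := {e | e ∈ K.edgeSet ∧ u ∉ e}
  subset_vertexSet_of_mem_edgeSet' := by
    intro e he x hx
    exact ⟨K.subset_vertexSet_of_mem_edgeSet' he.1 hx, fun h => he.2 (h ▸ hx)⟩

/-! ### Matching polynomial and matching energy -/

/-- The number of `k`-matchings, that is, of sets of `k` pairwise disjoint edges. -/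
def matchingCount {α : Type*} (K : Hypergraph α) (k : ℕ) : ℕ :=
  Set.ncard {M : Finset (Set α) |
    (M : Set (Set α)) ⊆ K.edgeSet ∧ (M : Set (Set α)).PairwiseDisjoint id ∧ M.card = k}

/-- The matching polynomial `∑_{k ≥ 0} (-1)^k m(K, k) X^(n - k r)` of an `r`-uniform hypergraph with
`n` vertices. A `k`-matching covers `k r` vertices, so only the terms with `k ≤ n / r` occur. -/
def matchingPolynomial {α : Type*} (r : ℕ) (K : Hypergraph α) : Polynomial ℤ :=
  ∑ k ∈ Finset.range (K.vertexSet.ncard / r + 1),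
    Polynomial.monomial (K.vertexSet.ncard - k * r) ((-1 : ℤ) ^ k * (K.matchingCount k : ℤ))

/-- The matching energy: the sum of the moduli of the complex roots of the matching polynomial,
counted with multiplicity. -/
def matchingEnergy {α : Type*} (r : ℕ) (K : Hypergraph α) : ℝ :=
  (((matchingPolynomial r K).aroots ℂ).map (fun z : ℂ => ‖z‖)).sum

/-! ### Tensors, their eigenvalues, and the spectral radius -/

/-- The vector `A x` for a real tensor `A` of order `q + 1` with indices in a finite type `ι` and
`x ∈ ℂ^ι`: its entry at `i` is `∑ a_{i i₂ … i_{q+1}} x_{i₂} ⋯ x_{i_{q+1}}`. -/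
def tensorApply {ι : Type*} {q : ℕ} (A : (Fin (q + 1) → ι) → ℝ) (x : ι → ℂ) (i : ι) : ℂ :=
  ∑ᶠ j : Fin q → ι, ((A (Fin.cons i j) : ℝ) : ℂ) * ∏ t : Fin q, x (j t)

/-- `z` is an eigenvalue of the tensor `A` of order `q + 1`: some nonzero complex vector `x`
satisfies `(A x)_i = z x_i^q` for all `i`. -/
def IsTensorEigenvalue {ι : Type*} {q : ℕ} (A : (Fin (q + 1) → ι) → ℝ) (z : ℂ) : Prop :=
  ∃ x : ι → ℂ, x ≠ 0 ∧ ∀ i, tensorApply A x i = z * x i ^ q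

open Classical in
/-- The adjacency tensor of an `r`-uniform hypergraph. Its order is `(r - 1) + 1`, which is `r` for
`r ≥ 1`; the entry at `i₁ … i_r` is `1 / (r - 1)!` if `{i₁, …, i_r}` is an edge, and `0` otherwise. -/
def adjacencyTensor {α : Type*} (r : ℕ) (K : Hypergraph α) :
    (Fin (r - 1 + 1) → K.vertexSet) → ℝ :=
  fun i => if Set.range (fun t => (i t : α)) ∈ K.edgeSet then 1 / ((r - 1).factorial : ℝ) else 0

/-- `ρ` is the spectral radius of the `r`-uniform hypergraph `K`: the maximum modulus of the
eigenvalues of its adjacency tensor. -/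
def IsSpectralRadius {α : Type*} (r : ℕ) (K : Hypergraph α) (ρ : ℝ) : Prop :=
  IsGreatest {s : ℝ | ∃ z : ℂ, IsTensorEigenvalue (adjacencyTensor r K) z ∧ s = ‖z‖} ρ

/-! ### Gluing at a common vertex -/

/-- The disjoint union of a family of hypergraphs. -/
def disjointUnion {ι α : Type*} (K : ι → Hypergraph α) : Hypergraph (ι × α) where
  vertexSet := {p | p.2 ∈ (K p.1).vertexSet}
  edgeSet := {f | ∃ i, ∃ e ∈ (K i).edgeSet, f = (fun x => (i, x)) '' e}
  subset_vertexSet_of_mem_edgeSet' := by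
    rintro _ ⟨i, e, he, rfl⟩ _ ⟨x, hx, rfl⟩
    exact (K i).subset_vertexSet_of_mem_edgeSet' he hx

open Classical in
/-- The map that identifies all the roots `(i, w i)` with one point `none`, and nothing else. -/
def identifyRoots {ι α : Type*} (w : ι → α) (p : ι × α) : Option (ι × α) :=
  if p.2 = w p.1 then none else some p

/-- The hypergraph obtained from disjoint copies of the `K i` by identifying all the roots `w i`
with one another. -/
def coalescence {ι α : Type*} (K : ι → Hypergraph α) (w : ι → α) : Hypergraph (Option (ι × α)) :=
  (disjointUnion K).image (identifyRoots w)

/-- The hypergraph `H_v^(m-k) · G_u^k` (for `k ≤ m`): `k` copies of `G` and `m - k` copies of `H`,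
with all the copies of `u` and of `v` identified to a single vertex. -/
def mixedPower {α : Type*} (G : Hypergraph α) (u : α) (H : Hypergraph α) (v : α) (m k : ℕ) :
    Hypergraph (Option (Fin m × α)) :=
  coalescence (fun i : Fin m => if i.val < k then G else H)
    (fun i : Fin m => if i.val < k then u else v)

end Hypergraph

end

/-! Spectral radius. Multiplied by `x i`, the eigenvalue equation at `i` says that the products of
`x` over the edges at `i` add up to `l * x i ^ r`. At a glued vertex the left side is the sum of the
contributions of the branches. A positive solution forces `l` to be the spectral radius
(`isSpectralRadius_of_pos`). So it is enough to find one `l` and positive vectors on `G` and on `H`,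
equal to 1 at the root, that solve the equations away from the root and contribute `l / m` there:
any `m` of them glue to an eigenvector for `l`, whatever `k` is (`isSpectralRadius_coalescence`).
Perron–Frobenius for one copy of `G` glued to one copy of `H`, with weight `2 / m` at the root,
yields such vectors, except that the contributions `l * d` and `l * d'` are only known to satisfy `d
+ d' = 2 / m`.

That `d = d'` follows from `φ(K, l) = (1 - d) * l * φ(K - u, l)` and `φ(K - u, l) > 0`
(`IsSupertree.aeval_matchingPolynomial_of_defect`): the two polynomials determine `d`. To prove
this, give each incidence `v ∈ e` the weight `(∏ j ∈ e, x j) / (l * x v ^ r)`. The weights at a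
vertex sum to 1 (to `d` at the root), and those along an edge multiply to `l ^ (-r)`. Let every
vertex choose an incident edge. Inclusion–exclusion writes the total weight of the choices in which
no edge is chosen by all its vertices as an alternating sum over matchings. A supertree with `q`
edges has `q * (r - 1) + 1` vertices, so by pigeonhole there are no such choices, and the sum
vanishes. If only the edges avoiding `u` are constrained, choosing an edge towards `u` is allowed,
whence positivity.

Matching energy. A matching of a coalescence is a family of matchings of the branches, at most one
of which covers its root. The numbers of matchings of a branch, by size and by whether they cover
the root, are determined by the two polynomials, so all the glued hypergraphs have the same matching
polynomial. -/

/-! ### Perron–Frobenius for weighted uniform set systems -/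

open Finset in
/-- **Perron–Frobenius** for a weighted uniform set system that no vertex set separates. -/
theorem exists_pos_eigenvector {V C : Type*} [Fintype V] [DecidableEq V] (D : Finset C)
    (S : C → Finset V) {r : ℕ} (hr : 0 < r) (hS : ∀ c ∈ D, (S c).card = r) (hD : D.Nonempty)
    (a : V → ℝ) (ha : ∀ i, 0 < a i)
    (hcut : ∀ p : V → Prop, (∃ x, p x) → (∃ x, ¬ p x) →
      ∃ c ∈ D, (∃ x ∈ S c, p x) ∧ ∃ x ∈ S c, ¬ p x) :
    ∃ l : ℝ, 0 < l ∧ ∃ x : V → ℝ, (∀ i, 0 < x i) ∧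
      ∀ i, ∑ c ∈ D with i ∈ S c, ∏ j ∈ S c, x j = l * a i * x i ^ r := by
  classical
  set N : (V → ℝ) → ℝ := fun x => ∑ i, a i * x i ^ r with hN
  set f : (V → ℝ) → ℝ := fun x => ∑ c ∈ D, ∏ j ∈ S c, x j with hf
  have hVne : Nonempty V := by
    obtain ⟨c, hc⟩ := hD
    obtain ⟨x, -⟩ : (S c).Nonempty := card_pos.1 (by rw [hS c hc]; exact hr)
    exact ⟨x⟩
  have hNpos : ∀ x ∈ stdSimplex ℝ V, 0 < N x := by
    intro x hx
    obtain ⟨i, hi⟩ : ∃ i, x i ≠ 0 := by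
      by_contra! h
      have := hx.2
      simp [h] at this
    exact sum_pos' (fun j _ => mul_nonneg (ha j).le (pow_nonneg (hx.1 j) _))
      ⟨i, mem_univ _, mul_pos (ha i) (pow_pos (lt_of_le_of_ne (hx.1 i) hi.symm) _)⟩
  have hNc : Continuous N := by fun_prop
  have hfc : Continuous f := by fun_prop
  -- Both `f` and `N` are homogeneous of degree `r`, so a maximum of `f / N` on the simplex bounds
  -- it on all nonzero nonnegative vectors.
  obtain ⟨x, hx, hmax⟩ := (isCompact_stdSimplex ℝ V).exists_isMaxOn
    ⟨_, single_mem_stdSimplex ℝ hVne.some⟩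
    (f := fun x => f x / N x)
    (hfc.continuousOn.div hNc.continuousOn fun x hx => (hNpos x hx).ne')
  set l := f x / N x with hl
  have hNs : ∀ (t : ℝ) y, N (t • y) = t ^ r * N y := by
    intro t y
    simp only [hN, Pi.smul_apply, smul_eq_mul, mul_pow, mul_sum]
    exact sum_congr rfl fun i _ => by ring
  have hfs : ∀ (t : ℝ) y, f (t • y) = t ^ r * f y := by
    intro t y
    simp only [hf, Pi.smul_apply, smul_eq_mul, prod_mul_distrib, mul_sum, prod_const]
    exact sum_congr rfl fun c hc => by rw [hS c hc]
  have hle : ∀ y : V → ℝ, (∀ i, 0 ≤ y i) → f y ≤ l * N y := by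
    intro y hy
    rcases (sum_nonneg fun i _ => hy i : 0 ≤ ∑ i, y i).eq_or_lt with h0 | hpos
    · have hy0 : y = (0 : ℝ) • y := by
        ext i
        simpa using (sum_eq_zero_iff_of_nonneg fun i _ => hy i).1 h0.symm i (mem_univ i)
      rw [hy0, hNs, hfs]
      simp [hr.ne']
    · set s := ∑ i, y i with hs
      have hmem : s⁻¹ • y ∈ stdSimplex ℝ V := by
        refine ⟨fun i => mul_nonneg (inv_nonneg.2 hpos.le) (hy i), ?_⟩
        simp only [Pi.smul_apply, smul_eq_mul, ← mul_sum]
        exact inv_mul_cancel₀ hpos.ne'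
      have h1 := hmax hmem
      simp only [Set.mem_ofPred_eq] at h1
      rw [div_le_iff₀ (hNpos _ hmem), hNs, hfs] at h1
      have h2 : 0 < s⁻¹ ^ r := by positivity
      nlinarith [h1]
  have heq : f x = l * N x := by rw [hl, div_mul_cancel₀ _ (hNpos x hx).ne']
  have hlpos : 0 < l := by
    have h1 := hle (fun _ => 1) fun _ => zero_le_one
    have h2 : 0 < f fun _ => 1 := by simpa [hf] using hD
    have h3 : 0 ≤ N fun _ => 1 := by
      simpa [hN] using sum_nonneg fun i _ => (ha i).le
    by_contra! h
    nlinarith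
  have hxpos : ∀ i, 0 < x i := by
    by_contra! hz
    obtain ⟨z, hz⟩ := hz
    obtain ⟨c, hc, ⟨i, hi, hi0⟩, j, hj, hj0⟩ := hcut (fun i => x i = 0)
      ⟨z, le_antisymm hz (hx.1 z)⟩ (by
        by_contra! h
        have := hx.2
        simp [h] at this)
    set c0 := ∏ j ∈ S c with x j ≠ 0, x j with hc0
    have hc0pos : 0 < c0 := prod_pos fun j hj =>
      lt_of_le_of_ne (hx.1 j) (mem_filter.1 hj).2.symm
    set A := ∑ i with x i = 0, a i with hA
    have hA0 : 0 ≤ A := sum_nonneg fun i _ => (ha i).le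
    -- Raising the zero entries to `ε` costs `ε ^ r * A` in `N`, but gains at least `ε ^ (r - 1) *
    -- c0` in `f`: the crossing set `S c` has at most `r - 1` zero entries. For small `ε` this
    -- contradicts maximality.
    have key : ∀ ε : ℝ, 0 < ε → ε ≤ 1 → c0 ≤ l * A * ε := by
      intro ε hε hε1
      set y : V → ℝ := fun i => if x i = 0 then ε else x i with hy
      have hxy : ∀ i, x i ≤ y i := by
        intro i
        by_cases h : x i = 0 <;> simp [hy, h, hε.le]
      have hNy : N y = N x + ε ^ r * A := by
        simp only [hN, hA, mul_sum, sum_filter, ← sum_add_distrib]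
        refine sum_congr rfl fun i _ => ?_
        by_cases h : x i = 0
        · simp [hy, h, hr.ne', mul_comm]
        · simp [hy, h]
      have hfy : f x + ε ^ (r - 1) * c0 ≤ f y := by
        simp only [hf]
        rw [← add_sum_erase D _ hc, ← add_sum_erase D _ hc, prod_eq_zero hi hi0, zero_add, add_comm]
        refine add_le_add ?_ (sum_le_sum fun d _ => prod_le_prod (fun i _ => hx.1 i)
          fun i _ => hxy i)
        rw [← prod_filter_mul_prod_filter_not (S c) (fun i => x i = 0) y]
        have h1 : ∏ i ∈ S c with ¬ x i = 0, y i = c0 :=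
          prod_congr rfl fun i hi => by simp [hy, (mem_filter.1 hi).2]
        have h2 : ∏ i ∈ S c with x i = 0, y i = ε ^ (#{i ∈ S c | x i = 0}) := by
          rw [← prod_const]
          exact prod_congr rfl fun i hi => by simp [hy, (mem_filter.1 hi).2]
        rw [h1, h2]
        refine mul_le_mul_of_nonneg_right (pow_le_pow_of_le_one hε.le hε1 ?_) hc0pos.le
        have : #{i ∈ S c | x i = 0} < r := by
          rw [← hS c hc]
          exact card_lt_card (filter_ssubset.2 ⟨j, hj, hj0⟩)
        omega
      have h1 := hle y fun i => (hx.1 i).trans (hxy i)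
      have h2 : ε ^ (r - 1) * c0 ≤ ε ^ (r - 1) * (l * A * ε) := by
        have : ε ^ r = ε ^ (r - 1) * ε := by rw [← pow_succ, Nat.sub_add_cancel hr]
        rw [hNy, this] at h1
        nlinarith
      exact le_of_mul_le_mul_left h2 (by positivity)
    have hlA : 0 ≤ l * A := mul_nonneg hlpos.le hA0
    -- The case `ε = 1` shows `l * A ≥ c0 > 0`, so the next choice of `ε` is admissible; it gives
    -- `c0 ≤ c0 / 2`.
    have h1 := key 1 one_pos le_rfl
    have h2 := key (c0 / (2 * (l * A))) (div_pos hc0pos (by linarith))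
      ((div_le_one (by linarith)).2 (by linarith))
    have h3 : l * A * (c0 / (2 * (l * A))) = c0 / 2 := by
      have : l * A ≠ 0 := by linarith
      generalize l * A = q at *
      field_simp
    linarith
  -- The factor `r` comes from differentiating `x i ^ r`: the partial derivative of `l * N - f`
  -- vanishes at its minimum, and is then multiplied by `x i`.
  refine ⟨l * r, by positivity, x, hxpos, fun i => ?_⟩
  set d := ∑ c ∈ D with i ∈ S c, ∏ j ∈ (S c).erase i, x j with hd
  have hNu : ∀ s, N (Function.update x i s) = a i * s ^ r + ∑ j ∈ univ.erase i, a j * x j ^ r := by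
    intro s
    simp only [hN]
    rw [← add_sum_erase _ _ (mem_univ i)]
    congr 1
    · simp
    · exact sum_congr rfl fun j hj => by simp [Function.update_of_ne (ne_of_mem_erase hj)]
  have hprod : ∀ s, ∀ c, i ∈ S c →
      ∏ j ∈ S c, Function.update x i s j = s * ∏ j ∈ (S c).erase i, x j := by
    intro s c hi
    rw [← mul_prod_erase _ _ hi]
    congr 1
    · simp
    · exact prod_congr rfl fun j hj => by simp [Function.update_of_ne (ne_of_mem_erase hj)]
  have hfu : ∀ s, f (Function.update x i s) =
      s * d + ∑ c ∈ D with i ∉ S c, ∏ j ∈ S c, x j := by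
    intro s
    simp only [hf]
    rw [← sum_filter_add_sum_filter_not D (fun c => i ∈ S c), hd, mul_sum]
    congr 1
    · exact sum_congr rfl fun c hc => hprod s c (mem_filter.1 hc).2
    · refine sum_congr rfl fun c hc => prod_congr rfl fun j hj => ?_
      rw [Function.update_of_ne]
      rintro rfl
      exact (mem_filter.1 hc).2 hj
  set g : ℝ → ℝ := fun s => l * N (Function.update x i s) - f (Function.update x i s) with hg
  have hmin : IsLocalMin g (x i) := by
    filter_upwards [lt_mem_nhds (hxpos i)] with s hs
    have h0 : g (x i) = 0 := by simp [hg, heq]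
    rw [h0]
    refine sub_nonneg.2 (hle _ fun j => ?_)
    by_cases h : j = i
    · subst h; simpa using hs.le
    · simpa [h] using (hxpos j).le
  have hder : HasDerivAt g (l * (a i * (r * x i ^ (r - 1))) - 1 * d) (x i) := by
    simp only [hg, hNu, hfu]
    exact ((((hasDerivAt_pow r (x i)).const_mul (a i)).add_const _).const_mul l).sub
      (((hasDerivAt_id (x i)).mul_const d).add_const _)
  have h0 := hmin.hasDerivAt_eq_zero hder
  have h1 : ∑ c ∈ D with i ∈ S c, ∏ j ∈ S c, x j = x i * d := by
    rw [hd, mul_sum]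
    exact sum_congr rfl fun c hc => (mul_prod_erase _ _ (mem_filter.1 hc).2).symm
  have h2 : x i ^ r = x i ^ (r - 1) * x i := by rw [← pow_succ, Nat.sub_add_cancel hr]
  rw [h1, h2]
  linear_combination (-x i) * h0

/-! ### The adjacency tensor and positive eigenvectors -/

theorem card_functions_image_eq {V : Type*} [Fintype V] [DecidableEq V] {q : ℕ} (U : Finset V)
    (hU : U.card = q) :
    (Finset.univ.filter fun j : Fin q → V => Finset.univ.image j = U).card = q.factorial := by
  have himg : (Finset.univ.filter fun j : Fin q → V => Finset.univ.image j = U) =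
      Finset.univ.image fun (σ : Fin q ≃ U) t => (σ t : V) := by
    ext j
    simp only [Finset.mem_filter, Finset.mem_univ, true_and, Finset.mem_image]
    constructor
    · intro h
      have hinj : Function.Injective j := by
        rw [← Set.injOn_univ, ← Finset.coe_univ, ← Finset.card_image_iff, h, hU]
        simp
      have hmem : ∀ t, j t ∈ U := fun t => h ▸ Finset.mem_image_of_mem _ (Finset.mem_univ t)
      refine ⟨Equiv.ofBijective (fun t => ⟨j t, hmem t⟩) ⟨fun s t hst => hinj (by simpa using hst),
        ?_⟩, rfl⟩
      rintro ⟨y, hy⟩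
      rw [← h] at hy
      obtain ⟨t, -, rfl⟩ := Finset.mem_image.1 hy
      exact ⟨t, rfl⟩
    · rintro ⟨σ, rfl⟩
      ext y
      simp only [Finset.mem_image, Finset.mem_univ, true_and]
      constructor
      · rintro ⟨t, rfl⟩
        exact (σ t).2
      · intro hy
        exact ⟨σ.symm ⟨y, hy⟩, by simp⟩
  rw [himg, Finset.card_image_of_injective]
  · rw [Finset.card_univ, Fintype.card_equiv (Fintype.equivOfCardEq (by simp [hU]))]
    simp
  · intro σ τ h
    ext t
    exact congrFun h t

namespace Hypergraph

theorem finite_edgeSet {α : Type*} {K : Hypergraph α} (hK : K.vertexSet.Finite) :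
    K.edgeSet.Finite :=
  hK.finite_subsets.subset fun _ he => K.subset_vertexSet_of_mem_edgeSet' he

/-- The sum over the edges `e` at `i` of the products of the entries of `x` over `e`. -/
noncomputable def edgeSum {α : Type*} (K : Hypergraph α) (x : α → ℝ) (i : α) : ℝ :=
  ∑ᶠ e ∈ {e | e ∈ K.edgeSet ∧ i ∈ e}, ∏ᶠ j ∈ e, x j

open Classical in
/-- The vertices of `K` in `e`, as elements of the vertex type of `K`. -/
noncomputable def vertexFinset {α : Type*} (K : Hypergraph α) [Fintype K.vertexSet] (e : Set α) :
    Finset K.vertexSet :=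
  Finset.univ.filter fun v => (v : α) ∈ e

section Finite

variable {α : Type*} {K : Hypergraph α} [Fintype K.vertexSet]

@[simp]
theorem mem_vertexFinset {e : Set α} {v : K.vertexSet} : v ∈ K.vertexFinset e ↔ (v : α) ∈ e := by
  simp [vertexFinset]

theorem image_vertexFinset {e : Set α} (he : e ∈ K.edgeSet) :
    (Subtype.val '' (K.vertexFinset e : Set K.vertexSet)) = e := by
  ext v
  constructor
  · rintro ⟨w, hw, rfl⟩
    simpa using hw
  · intro hv
    exact ⟨⟨v, K.subset_vertexSet_of_mem_edgeSet' he hv⟩, by simpa using hv, rfl⟩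

theorem card_vertexFinset {e : Set α} (he : e ∈ K.edgeSet) :
    (K.vertexFinset e).card = e.ncard := by
  conv_rhs => rw [← image_vertexFinset he]
  rw [Set.ncard_image_of_injective _ Subtype.val_injective, Set.ncard_coe_finset]

theorem finprod_mem_edge {e : Set α} (he : e ∈ K.edgeSet) (x : α → ℝ) :
    ∏ᶠ j ∈ e, x j = ∏ j ∈ K.vertexFinset e, x j := by
  conv_lhs => rw [← image_vertexFinset he]
  rw [finprod_mem_image Subtype.val_injective.injOn, finprod_mem_coe_finset]

theorem edgeSum_eq (hE : K.edgeSet.Finite) (x : α → ℝ) (i : K.vertexSet) [DecidableEq K.vertexSet] :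
    K.edgeSum x i =
      ∑ e ∈ hE.toFinset with i ∈ K.vertexFinset e, ∏ j ∈ K.vertexFinset e, x j := by
  classical
  rw [edgeSum, finsum_mem_congr rfl fun e he => finprod_mem_edge he.1 x,
    ← finsum_mem_coe_finset]
  congr 1
  ext e
  simp

-- The nonzero terms at an edge `e` come from the `(r - 1)!` orderings of `e` without `i`, which
-- cancel the normalisation of the tensor.
open Finset in
theorem tensorApply_adjacencyTensor {r : ℕ} (hr : 0 < r) (hU : K.IsUniform r)
    (hE : K.edgeSet.Finite) [DecidableEq K.vertexSet] (x : K.vertexSet → ℂ) (i : K.vertexSet) :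
    tensorApply (adjacencyTensor r K) x i =
      ∑ e ∈ hE.toFinset with i ∈ K.vertexFinset e, ∏ j ∈ (K.vertexFinset e).erase i, x j := by
  classical
  rw [tensorApply, finsum_eq_sum_of_fintype]
  have hrange : ∀ e ∈ K.edgeSet, ∀ j : Fin (r - 1) → K.vertexSet,
      Set.range (fun t => ((Fin.cons i j : Fin (r - 1 + 1) → K.vertexSet) t : α)) = e ↔
        i ∈ K.vertexFinset e ∧ univ.image j = (K.vertexFinset e).erase i := by
    intro e he j
    have h1 : Set.range (fun t => ((Fin.cons i j : Fin (r - 1 + 1) → K.vertexSet) t : α)) = e ↔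
        insert i (univ.image j) = K.vertexFinset e := by
      have h2 : Set.range (fun t => ((Fin.cons i j : Fin (r - 1 + 1) → K.vertexSet) t : α)) =
          Subtype.val '' ((insert i (univ.image j) : Finset K.vertexSet) : Set K.vertexSet) := by
        rw [Set.range_comp' Subtype.val, Fin.range_cons]
        simp
      rw [h2]
      conv_lhs => rw [← image_vertexFinset he]
      rw [(Set.image_injective.2 Subtype.val_injective).eq_iff, Finset.coe_inj]
    rw [h1]
    constructor
    · intro h
      have hi : i ∈ K.vertexFinset e := h ▸ mem_insert_self _ _
      refine ⟨hi, ?_⟩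
      rw [← h, erase_insert]
      intro hmem
      rw [insert_eq_of_mem hmem] at h
      have h3 : (univ.image j).card ≤ r - 1 := card_image_le.trans (by simp)
      rw [h, card_vertexFinset he, hU e he] at h3
      omega
    · rintro ⟨hi, h⟩
      rw [h, insert_erase hi]
  have hterm : ∀ j : Fin (r - 1) → K.vertexSet,
      ((adjacencyTensor r K (Fin.cons i j) : ℝ) : ℂ) * ∏ t, x (j t) =
      ∑ e ∈ hE.toFinset, if i ∈ K.vertexFinset e ∧ univ.image j = (K.vertexFinset e).erase i then
        1 / ((r - 1).factorial : ℂ) * ∏ k ∈ (K.vertexFinset e).erase i, x k else 0 := by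
    intro j
    have h1 : ∀ e ∈ hE.toFinset,
        (if i ∈ K.vertexFinset e ∧ univ.image j = (K.vertexFinset e).erase i then
          1 / ((r - 1).factorial : ℂ) * ∏ k ∈ (K.vertexFinset e).erase i, x k else 0) =
        if Set.range (fun t => ((Fin.cons i j : Fin (r - 1 + 1) → K.vertexSet) t : α)) = e then
          1 / ((r - 1).factorial : ℂ) * ∏ t, x (j t) else 0 := by
      intro e he
      have he' : e ∈ K.edgeSet := by simpa using he
      simp only [← hrange e he' j]
      split_ifs with h
      · obtain ⟨hi, h2⟩ := (hrange e he' j).1 h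
        rw [← h2, prod_image]
        have h3 : (univ.image j).card = (univ : Finset (Fin (r - 1))).card := by
          rw [h2, card_erase_of_mem hi, card_vertexFinset he', hU e he']
          simp
        exact card_image_iff.1 h3
      · rfl
    rw [sum_congr rfl h1, sum_ite_eq]
    simp only [adjacencyTensor, Set.Finite.mem_toFinset]
    split_ifs <;> simp
  rw [sum_congr rfl fun j _ => hterm j, sum_comm, sum_filter]
  refine sum_congr rfl fun e he => ?_
  have he' : e ∈ K.edgeSet := by simpa using he
  split_ifs with hi
  · simp only [hi, true_and]
    rw [← sum_filter, sum_const, card_functions_image_eq]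
    · have : ((r - 1).factorial : ℂ) ≠ 0 := by exact_mod_cast (r - 1).factorial_ne_zero
      rw [nsmul_eq_mul, ← mul_assoc, mul_one_div_cancel this, one_mul]
    · rw [card_erase_of_mem hi, card_vertexFinset he', hU e he']
  · simp [hi]

end Finite

open Finset in
/-- The eigenvalue of a positive eigenvector is the spectral radius. -/
theorem isSpectralRadius_of_pos {α : Type*} {K : Hypergraph α} {r : ℕ} (hr : 0 < r)
    (hV : K.vertexSet.Finite) (hne : K.vertexSet.Nonempty) (hU : K.IsUniform r) {l : ℝ}
    (hl : 0 ≤ l) (x : α → ℝ) (hx : ∀ i, 0 < x i)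
    (heq : ∀ i ∈ K.vertexSet, K.edgeSum x i = l * x i ^ r) : IsSpectralRadius r K l := by
  classical
  have := hV.fintype
  have hE := finite_edgeSet hV
  have hnev : Nonempty K.vertexSet := hne.to_subtype
  -- `edgeSum` carries an extra factor `x i`; cancelling it recovers the tensor equation.
  have hvec : ∀ i : K.vertexSet, ∑ e ∈ hE.toFinset with i ∈ K.vertexFinset e,
      ∏ j ∈ (K.vertexFinset e).erase i, x j = l * x i ^ (r - 1) := by
    intro i
    have h1 := heq i i.2
    rw [edgeSum_eq hE, sum_congr rfl fun e he => (mul_prod_erase _ (fun j : K.vertexSet => x j)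
      (mem_filter.1 he).2).symm, ← mul_sum] at h1
    have h2 : x i ^ r = x i ^ (r - 1) * x i := by rw [← pow_succ, Nat.sub_add_cancel hr]
    refine mul_left_cancel₀ (hx i).ne' (h1.trans ?_)
    rw [h2]
    ring
  constructor
  · refine ⟨l, ⟨fun i => (x i : ℂ), ?_, fun i => ?_⟩, by simp [abs_of_nonneg hl]⟩
    · intro h
      have := congrFun h hnev.some
      simp [(hx _).ne'] at this
    · rw [tensorApply_adjacencyTensor hr hU hE]
      beta_reduce
      exact_mod_cast hvec i
  · rintro s ⟨z, ⟨y, hy0, hy⟩, rfl⟩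
    -- Where `‖y i‖ / x i` is largest, the triangle inequality compares the equation for `y` with
    -- that for `t • x`.
    obtain ⟨i, -, hi⟩ := exists_max_image univ (fun i : K.vertexSet => ‖y i‖ / x i)
      ⟨hnev.some, mem_univ _⟩
    set t := ‖y i‖ / x i with ht
    have hyi : ‖y i‖ = t * x i := by rw [ht, div_mul_cancel₀ _ (hx i).ne']
    have hle : ∀ j, ‖y j‖ ≤ t * x j := fun j => (div_le_iff₀ (hx j)).1 (hi j (mem_univ _))
    have htpos : 0 < t := by
      obtain ⟨j, hj⟩ := Function.ne_iff.1 hy0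
      have h1 : 0 < t * x j := (norm_pos_iff.2 hj).trans_le (hle j)
      exact pos_of_mul_pos_left h1 (hx j).le
    have h1 : ‖z‖ * (t * x i) ^ (r - 1) ≤ t ^ (r - 1) * (l * x i ^ (r - 1)) := by
      rw [← hvec i, ← hyi, ← norm_pow, ← norm_mul, ← hy i, tensorApply_adjacencyTensor hr hU hE,
        mul_sum]
      refine norm_sum_le_of_le _ fun e he => ?_
      rw [norm_prod]
      have hcard : ((K.vertexFinset e).erase i).card = r - 1 := by
        obtain ⟨he1, he2⟩ := mem_filter.1 he
        have he' : e ∈ K.edgeSet := by simpa using he1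
        rw [card_erase_of_mem he2, card_vertexFinset he', hU e he']
      rw [← hcard, ← prod_const, ← prod_mul_distrib]
      exact prod_le_prod (fun j _ => norm_nonneg _) fun j _ => hle j
    have h2 : 0 < (t * x i) ^ (r - 1) := pow_pos (mul_pos htpos (hx i)) _
    refine le_of_mul_le_mul_right (h1.trans_eq ?_) h2
    rw [mul_pow]
    ring

end Hypergraph

/-! ### The incidence graph and the vertex count of a supertree -/

namespace Hypergraph

variable {α : Type*} {K : Hypergraph α}

/-- The bipartite graph of vertices and edges of a hypergraph. -/
def incidenceGraph (K : Hypergraph α) : SimpleGraph (K.vertexSet ⊕ K.edgeSet) where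
  Adj
    | .inl v, .inr e => (v : α) ∈ (e : Set α)
    | .inr e, .inl v => (v : α) ∈ (e : Set α)
    | _, _ => False
  symm := ⟨by rintro (v | e) (w | f) h <;> exact h⟩
  loopless := ⟨by rintro (v | e) h <;> exact h⟩

@[simp]
theorem incidenceGraph_adj_inl_inr {v : K.vertexSet} {e : K.edgeSet} :
    K.incidenceGraph.Adj (.inl v) (.inr e) ↔ (v : α) ∈ (e : Set α) := Iff.rfl

@[simp]
theorem incidenceGraph_adj_inr_inl {v : K.vertexSet} {e : K.edgeSet} :
    K.incidenceGraph.Adj (.inr e) (.inl v) ↔ (v : α) ∈ (e : Set α) := Iff.rfl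

theorem isLeft_of_incidenceGraph_adj {a b : K.vertexSet ⊕ K.edgeSet}
    (h : K.incidenceGraph.Adj a b) : b.isLeft = !a.isLeft := by
  rcases a with v | e <;> rcases b with w | f <;> first | rfl | exact h.elim

/-- A graph cycle alternates between vertices and edges of `K`. Hence its length is even and at
least 4, and reading it two steps at a time gives a hypergraph cycle. -/
theorem incidenceGraph_isAcyclic (hK : ¬ K.HasCycle) : K.incidenceGraph.IsAcyclic := by
  rw [SimpleGraph.isAcyclic_iff_free_cycleGraph]
  rintro n hn ⟨f⟩
  obtain ⟨m, rfl⟩ := Nat.exists_eq_add_of_le' hn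
  set g : ℕ → K.vertexSet ⊕ K.edgeSet := fun i => f (Fin.ofNat (m + 3) i) with hg
  have hgmod : ∀ i j, g i = g j ↔ i % (m + 3) = j % (m + 3) := by
    intro i j
    exact f.injective.eq_iff.trans Fin.ext_iff
  have hadj : ∀ i, K.incidenceGraph.Adj (g i) (g (i + 1)) := by
    intro i
    refine f.toHom.map_adj (SimpleGraph.cycleGraph_adj.2 (Or.inr ?_))
    rw [sub_eq_iff_eq_add]
    ext
    simp [Fin.val_add, add_comm]
  have hpar : ∀ i j, (g (i + 2 * j)).isLeft = (g i).isLeft := by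
    intro i j
    induction j with
    | zero => rfl
    | succ j ih =>
      rw [← ih, show i + 2 * (j + 1) = i + 2 * j + 1 + 1 by ring,
        isLeft_of_incidenceGraph_adj (hadj _), isLeft_of_incidenceGraph_adj (hadj _), Bool.not_not]
  obtain ⟨p, hp⟩ : ∃ p, m + 3 = 2 * (p + 2) := by
    rcases Nat.even_or_odd' (m + 3) with ⟨q, hq | hq⟩
    · exact ⟨q - 2, by omega⟩
    · exfalso
      have h0 : g (0 + 2 * q + 1) = g 0 := by rw [hgmod, zero_add, ← hq]; simp
      have h1 := isLeft_of_incidenceGraph_adj (hadj (0 + 2 * q))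
      rw [h0, hpar] at h1
      exact absurd h1 (by cases (g 0).isLeft <;> decide)
  obtain ⟨s, hs⟩ : ∃ s, (g s).isLeft = true := by
    cases h : (g 0).isLeft
    · exact ⟨1, by rw [← zero_add 1, isLeft_of_incidenceGraph_adj (hadj _), h]; rfl⟩
    · exact ⟨0, h⟩
  have hv : ∀ i : Fin (p + 2), ∃ v, g (s + 2 * i) = .inl v :=
    fun i => Sum.isLeft_iff.1 ((hpar s i).trans hs)
  have he : ∀ i : Fin (p + 2), ∃ e, g (s + 2 * i + 1) = .inr e := fun i =>
    Sum.isRight_iff.1 (by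
      rw [← Sum.not_isLeft, isLeft_of_incidenceGraph_adj (hadj _), hpar, hs]; simp)
  choose v hv using hv
  choose e he using he
  have hinj : ∀ (c : ℕ) (i j : Fin (p + 2)), g (c + 2 * i) = g (c + 2 * j) → i = j := by
    intro c i j h
    have h1 : 2 * (i : ℕ) ≡ 2 * j [MOD m + 3] := Nat.ModEq.add_left_cancel' c ((hgmod _ _).1 h)
    have hi := i.2
    have hj := j.2
    have h2 := h1.eq_of_lt_of_lt (by omega) (by omega)
    ext
    omega
  refine hK ⟨p, fun i => v i, fun i => e i, ?_, ?_, fun i => ⟨(e i).2, ?_, ?_⟩⟩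
  · intro i j hij
    have : v i = v j := Subtype.ext hij
    exact hinj s i j (by rw [hv, hv, this])
  · intro i j hij
    have : e i = e j := Subtype.ext hij
    refine hinj (s + 1) i j ?_
    rw [show s + 1 + 2 * (i : ℕ) = s + 2 * i + 1 by ring,
      show s + 1 + 2 * (j : ℕ) = s + 2 * j + 1 by ring, he, he, this]
  · have h := hadj (s + 2 * i)
    rwa [hv, he] at h
  · have h := hadj (s + 2 * i + 1)
    -- Closing up: since `m + 3 = 2 * (p + 2)`, the successor modulo `p + 2` is two steps modulo `m
    -- + 3`.
    have h1 : g (s + 2 * i + 1 + 1) = g (s + 2 * ((i + 1 : Fin (p + 2)) : ℕ)) := by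
      rw [hgmod, hp]
      have h2 : ((i + 1 : Fin (p + 2)) : ℕ) = (i + 1) % (p + 2) := by
        simp [Fin.val_add]
      rw [h2, ← Nat.mul_mod_mul_left, Nat.add_mod_mod]
      ring_nf
    rwa [h1, hv, he] at h

theorem incidenceGraph_connected {r : ℕ} (hr : 0 < r) (hU : K.IsUniform r) (hK : K.IsConnected) :
    K.incidenceGraph.Connected := by
  have hvv : ∀ v w : K.vertexSet, K.incidenceGraph.Reachable (.inl v) (.inl w) := by
    intro v w
    have key : ∀ y, Relation.ReflTransGen K.Adj v y → ∀ hy : y ∈ K.vertexSet,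
        K.incidenceGraph.Reachable (.inl v) (.inl ⟨y, hy⟩) := by
      intro y h
      induction h with
      | refl => exact fun _ => .rfl
      | tail _ hab ih =>
        intro hb
        obtain ⟨e, he, ha', hb'⟩ := hab
        have h1 : K.incidenceGraph.Adj
          (.inl ⟨_, K.subset_vertexSet_of_mem_edgeSet' he ha'⟩) (.inr ⟨e, he⟩) := ha'
        have h2 : K.incidenceGraph.Adj (.inr ⟨e, he⟩) (.inl ⟨_, hb⟩) := hb'
        exact ((ih _).trans h1.reachable).trans h2.reachable
    exact key w (hK.2 v v.2 w w.2) w.2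
  obtain ⟨u, hu⟩ := hK.1
  refine (SimpleGraph.connected_iff_exists_forall_reachable _).2 ⟨.inl ⟨u, hu⟩, ?_⟩
  rintro (v | ⟨e, he⟩)
  · exact hvv _ _
  · obtain ⟨y, hy⟩ := Set.nonempty_of_ncard_ne_zero (s := e) (by rw [hU e he]; omega)
    have h1 : K.incidenceGraph.Adj
      (.inl ⟨y, K.subset_vertexSet_of_mem_edgeSet' he hy⟩) (.inr ⟨e, he⟩) := hy
    exact (hvv _ _).trans h1.reachable

/-- A supertree with `n` vertices and `q` edges satisfies `q r + 1 = n + q`. -/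
theorem IsSupertree.ncard_edgeSet {r : ℕ} (hr : 0 < r) (hK : K.IsSupertree r) :
    K.edgeSet.ncard * r + 1 = K.vertexSet.ncard + K.edgeSet.ncard := by
  classical
  have := hK.finite.fintype
  have := (finite_edgeSet hK.finite).fintype
  -- A tree has one edge fewer than nodes; its edges are counted from the hyperedge side, where
  -- every degree is `r`.
  have htree : K.incidenceGraph.IsTree :=
    ⟨incidenceGraph_connected hr hK.uniform hK.connected, incidenceGraph_isAcyclic hK.acyclic⟩
  have hbip : K.incidenceGraph.IsBipartiteWith
      ((Finset.univ.map ⟨Sum.inl, Sum.inl_injective⟩ : Finset (K.vertexSet ⊕ K.edgeSet)) :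
        Set (K.vertexSet ⊕ K.edgeSet))
      ((Finset.univ.map ⟨Sum.inr, Sum.inr_injective⟩ : Finset (K.vertexSet ⊕ K.edgeSet)) :
        Set (K.vertexSet ⊕ K.edgeSet)) := by
    refine ⟨?_, ?_⟩
    · rw [Set.disjoint_left]
      rintro (v | e) h1 h2 <;> simp at h1 h2
    · rintro (v | e) (w | f) h
      · exact h.elim
      · simp
      · simp
      · exact h.elim
  have hdeg : ∀ e : K.edgeSet, K.incidenceGraph.degree (.inr e) = r := by
    intro e
    have hN : K.incidenceGraph.neighborFinset (.inr e) =
        (K.vertexFinset e).map ⟨Sum.inl, Sum.inl_injective⟩ := by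
      ext (v | f)
      · simp
      · simp only [SimpleGraph.mem_neighborFinset, Finset.mem_map, Function.Embedding.coeFn_mk,
          reduceCtorEq, and_false, exists_false, iff_false]
        exact fun h => h
    rw [← SimpleGraph.card_neighborFinset_eq_degree, hN, Finset.card_map, card_vertexFinset e.2,
      hK.uniform e e.2]
  have h1 := htree.card_edgeFinset
  rw [← SimpleGraph.isBipartiteWith_sum_degrees_eq_card_edges' hbip, Finset.sum_map] at h1
  simp only [Function.Embedding.coeFn_mk, hdeg, Finset.sum_const, Finset.card_univ, smul_eq_mul,
    Fintype.card_sum] at h1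
  rwa [← Nat.card_eq_fintype_card, ← Nat.card_eq_fintype_card, Nat.card_coe_set_eq,
    Nat.card_coe_set_eq] at h1

/-- In a connected hypergraph every vertex other than `u` lies in an edge that contains a vertex
of smaller rank. -/
theorem IsConnected.exists_rank (hK : K.IsConnected) {u : α} (hu : u ∈ K.vertexSet) :
    ∃ d : α → ℕ, ∀ v ∈ K.vertexSet, v ≠ u → ∃ e ∈ K.edgeSet, v ∈ e ∧ ∃ y ∈ e, d y < d v := by
  classical
  -- `L n` is the set of ends of `n`-step walks from `u`; the rank is the distance from `u`.
  let L : ℕ → Set α := fun n => Nat.rec {u} (fun _ s => {v | ∃ y ∈ s, K.Adj y v}) n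
  have hL : ∀ v, Relation.ReflTransGen K.Adj u v → ∃ n, v ∈ L n := by
    intro v h
    induction h with
    | refl => exact ⟨0, rfl⟩
    | tail _ hab ih => exact ⟨ih.choose + 1, _, ih.choose_spec, hab⟩
  refine ⟨fun v => sInf {n | v ∈ L n}, fun v hv hvu => ?_⟩
  have hs : v ∈ L (sInf {n | v ∈ L n}) := Nat.sInf_mem (hL v (hK.2 u hu v hv))
  obtain ⟨n, hn⟩ : ∃ n, sInf {n | v ∈ L n} = n + 1 := by
    refine Nat.exists_eq_succ_of_ne_zero fun h0 => hvu ?_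
    rwa [h0] at hs
  rw [hn] at hs
  obtain ⟨y, hy, e, he, hye, hve⟩ := hs
  refine ⟨e, he, hve, y, hye, ?_⟩
  beta_reduce
  rw [hn]
  exact Nat.lt_succ_of_le (Nat.sInf_le hy)

theorem IsConnected.exists_crossing_edge (hK : K.IsConnected) (p : α → Prop) {x y : α}
    (hx : x ∈ K.vertexSet) (hy : y ∈ K.vertexSet) (hpx : p x) (hpy : ¬ p y) :
    ∃ e ∈ K.edgeSet, (∃ a ∈ e, p a) ∧ ∃ b ∈ e, ¬ p b := by
  have h := hK.2 x hx y hy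
  clear hy
  induction h with
  | refl => exact absurd hpx hpy
  | @tail b c _ hbc ih =>
    by_cases hb : p b
    · obtain ⟨e, he, hbe, hce⟩ := hbc
      exact ⟨e, he, ⟨b, hbe, hb⟩, c, hce, hpy⟩
    · exact ih hb

end Hypergraph

/-! ### Inclusion–exclusion and the ratio of the matching polynomials -/

open Finset in
open scoped Classical in
/-- Inclusion–exclusion over the colour classes: if every `v` picks a colour `c ∈ D` with weight
`B v c`, then the colourings in which no set `S c` with `c ∈ E` is entirely coloured `c` are
counted by an alternating sum over the matchings in `E`. -/
theorem sum_matchings_eq_sum_colourings {V C : Type*} [Fintype V] [DecidableEq V]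
    (D E : Finset C) (hED : E ⊆ D) (S : C → Finset V) (B : V → C → ℝ) :
    ∑ M ∈ E.powerset.filter fun M : Finset C => (M : Set C).PairwiseDisjoint S,
        (-1 : ℝ) ^ #M * (∏ c ∈ M, ∏ v ∈ S c, B v c) *
          ∏ v with ∀ c ∈ M, v ∉ S c, ∑ c ∈ D, B v c =
      ∑ f ∈ Fintype.piFinset (fun _ : V => D) with ∀ c ∈ E, ∃ v ∈ S c, f v ≠ c,
        ∏ v, B v (f v) := by
  have hM : ∀ M ∈ E.powerset.filter fun M : Finset C => (M : Set C).PairwiseDisjoint S,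
      (-1 : ℝ) ^ #M * (∏ c ∈ M, ∏ v ∈ S c, B v c) *
          ∏ v with ∀ c ∈ M, v ∉ S c, ∑ c ∈ D, B v c =
      ∑ f ∈ Fintype.piFinset (fun _ : V => D),
        if ∀ c ∈ M, ∀ v ∈ S c, f v = c then (-1 : ℝ) ^ #M * ∏ v, B v (f v) else 0 := by
    intro M hM
    obtain ⟨hME, hpd⟩ := mem_filter.1 hM
    -- Expanding the product sums over the colourings that give each set `S c`, `c ∈ M`, its own
    -- colour `c`.
    have h1 : ∏ v, ∑ c ∈ D, (if ∀ c' ∈ M, v ∈ S c' → c = c' then B v c else 0) =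
        ∑ f ∈ Fintype.piFinset (fun _ : V => D),
          if ∀ c ∈ M, ∀ v ∈ S c, f v = c then ∏ v, B v (f v) else 0 := by
      rw [prod_univ_sum]
      refine sum_congr rfl fun f _ => ?_
      split_ifs with h
      · exact prod_congr rfl fun v _ => if_pos fun c hc hv => h c hc v hv
      · push Not at h
        obtain ⟨c, hc, v, hv, hne⟩ := h
        exact prod_eq_zero (mem_univ v) (if_neg fun h => hne (h c hc hv))
    have hcov : ∀ c ∈ M, ∀ v ∈ S c,
        ∑ c ∈ D, (if ∀ c' ∈ M, v ∈ S c' → c = c' then B v c else 0) = B v c := by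
      intro c hc v hv
      rw [sum_eq_single c]
      · refine if_pos fun c' hc' hv' => ?_
        by_contra hne
        exact disjoint_left.1 (hpd hc hc' hne) hv hv'
      · intro c' _ hne
        exact if_neg fun h => hne (h c hc hv)
      · exact fun h => absurd (hED (mem_powerset.1 hME hc)) h
    have hunc : ∀ v, (∀ c ∈ M, v ∉ S c) →
        ∑ c ∈ D, (if ∀ c' ∈ M, v ∈ S c' → c = c' then B v c else 0) = ∑ c ∈ D, B v c :=
      fun v hv => sum_congr rfl fun c _ => if_pos fun c' hc' hv' => absurd hv' (hv c' hc')
    have h2 : ∏ v, ∑ c ∈ D, (if ∀ c' ∈ M, v ∈ S c' → c = c' then B v c else 0) =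
        (∏ c ∈ M, ∏ v ∈ S c, B v c) * ∏ v with ∀ c ∈ M, v ∉ S c, ∑ c ∈ D, B v c := by
      rw [← prod_filter_mul_prod_filter_not univ (fun v => ∀ c ∈ M, v ∉ S c), mul_comm]
      congr 1
      · have h3 : univ.filter (fun v => ¬ ∀ c ∈ M, v ∉ S c) = M.biUnion S := by
          ext v
          simp
        rw [h3, prod_biUnion hpd]
        exact prod_congr rfl fun c hc => prod_congr rfl fun v hv => hcov c hc v hv
      · exact prod_congr rfl fun v hv => hunc v (mem_filter.1 hv).2
    rw [mul_assoc, ← h2, h1, mul_sum]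
    exact sum_congr rfl fun f _ => by rw [mul_ite, mul_zero]
  rw [sum_congr rfl hM, sum_comm, sum_filter]
  refine sum_congr rfl fun f _ => ?_
  rw [← sum_filter, ← sum_mul]
  -- Sets entirely of their own, distinct colours are automatically disjoint, so `M` runs over a
  -- full power set and its alternating sum is 0 unless no set is so coloured.
  have hU : ((E.powerset.filter fun M : Finset C => (M : Set C).PairwiseDisjoint S).filter
      fun M => ∀ c ∈ M, ∀ v ∈ S c, f v = c) = (E.filter fun c => ∀ v ∈ S c, f v = c).powerset := by
    ext M
    simp only [mem_filter, mem_powerset, subset_iff]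
    constructor
    · rintro ⟨⟨h1, -⟩, h2⟩ c hc
      exact ⟨h1 hc, h2 c hc⟩
    · intro h
      refine ⟨⟨fun c hc => (h hc).1, fun c hc c' hc' hne => disjoint_left.2 fun v hv hv' => ?_⟩,
        fun c hc => (h hc).2⟩
      exact hne (((h hc).2 v hv).symm.trans ((h hc').2 v hv'))
  have hsum := sum_powerset_neg_one_pow_card (x := E.filter fun c => ∀ v ∈ S c, f v = c)
  have hsum' := congrArg (Int.cast : ℤ → ℝ) hsum
  push_cast at hsum'
  rw [hU, hsum']
  have hiff : (E.filter fun c => ∀ v ∈ S c, f v = c) = ∅ ↔ ∀ c ∈ E, ∃ v ∈ S c, f v ≠ c := by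
    rw [filter_eq_empty_iff]
    push Not
    rfl
  simp only [hiff]
  split_ifs <;> simp

namespace Hypergraph

variable {α : Type*} {K : Hypergraph α}

section Matchings

open Finset
open scoped Classical

/-- The finite set of all matchings of a hypergraph. -/
noncomputable def matchings (K : Hypergraph α) (hE : K.edgeSet.Finite) : Finset (Finset (Set α)) :=
  hE.toFinset.powerset.filter fun M => (M : Set (Set α)).PairwiseDisjoint id

theorem mem_matchings {hE : K.edgeSet.Finite} {M : Finset (Set α)} :
    M ∈ K.matchings hE ↔
      (M : Set (Set α)) ⊆ K.edgeSet ∧ (M : Set (Set α)).PairwiseDisjoint id := by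
  simp [matchings, subset_iff, Set.subset_def]

theorem pairwiseDisjoint_vertexFinset_iff [Fintype K.vertexSet] {M : Finset (Set α)}
    (hM : (M : Set (Set α)) ⊆ K.edgeSet) :
    (M : Set (Set α)).PairwiseDisjoint K.vertexFinset ↔
      (M : Set (Set α)).PairwiseDisjoint id := by
  refine forall₅_congr fun e he f hf _ => ?_
  simp only [Function.onFun, id, Finset.disjoint_left, Set.disjoint_left, mem_vertexFinset]
  exact ⟨fun h a ha => h (a := ⟨a, K.subset_vertexSet_of_mem_edgeSet' (hM he) ha⟩) ha,
    fun h a ha => h ha⟩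

theorem card_mul_le_of_mem_matchings {r : ℕ} (hV : K.vertexSet.Finite) (hU : K.IsUniform r)
    {M : Finset (Set α)} (hM : M ∈ K.matchings (finite_edgeSet hV)) :
    #M * r ≤ K.vertexSet.ncard := by
  have := hV.fintype
  obtain ⟨h1, h2⟩ := mem_matchings.1 hM
  have h3 := card_biUnion ((pairwiseDisjoint_vertexFinset_iff h1).2 h2)
  rw [sum_congr rfl fun e he => (card_vertexFinset (h1 he)).trans (hU e (h1 he)), sum_const,
    smul_eq_mul] at h3
  rw [← h3, ← Nat.card_coe_set_eq, Nat.card_eq_fintype_card]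
  exact card_le_univ _

theorem matchingCount_eq (hE : K.edgeSet.Finite) (k : ℕ) :
    K.matchingCount k = #{M ∈ K.matchings hE | #M = k} := by
  rw [matchingCount, ← Set.ncard_coe_finset]
  congr 1
  ext M
  simp [mem_matchings, and_assoc]

/-- Factoring out `l ^ n` turns the polynomial into a sum over all matchings, the shape that
inclusion–exclusion produces. -/
theorem aeval_matchingPolynomial {r : ℕ} (hr : 0 < r) (hV : K.vertexSet.Finite)
    (hU : K.IsUniform r) {l : ℝ} (hl : l ≠ 0) :
    (matchingPolynomial r K).aeval l =
      l ^ K.vertexSet.ncard * ∑ M ∈ K.matchings (finite_edgeSet hV), (-(l ^ r)⁻¹) ^ #M := by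
  rw [matchingPolynomial, map_sum, ← sum_fiberwise_of_maps_to (g := card)
    (t := range (K.vertexSet.ncard / r + 1)) (fun M hM => ?_), mul_sum]
  · refine sum_congr rfl fun k hk => ?_
    have hkr : k * r ≤ K.vertexSet.ncard :=
      (Nat.le_div_iff_mul_le hr).1 (Nat.lt_succ_iff.1 (mem_range.1 hk))
    rw [sum_congr rfl fun M hM => by rw [(mem_filter.1 hM).2], sum_const, ← matchingCount_eq,
      Polynomial.aeval_monomial, pow_sub₀ l hl hkr, mul_comm k r, pow_mul, nsmul_eq_mul, neg_pow (l ^ r)⁻¹,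
      inv_pow]
    simp only [algebraMap_int_eq, eq_intCast, Int.cast_mul, Int.cast_pow, Int.cast_neg,
      Int.cast_one, Int.cast_natCast]
    ring
  · rw [mem_range, Nat.lt_succ_iff, Nat.le_div_iff_mul_le hr]
    exact card_mul_le_of_mem_matchings hV hU hM

theorem deleteVertex_finite (hV : K.vertexSet.Finite) (u : α) :
    (K.deleteVertex u).vertexSet.Finite := hV.subset Set.sdiff_subset

theorem deleteVertex_isUniform {r : ℕ} (hU : K.IsUniform r) (u : α) :
    (K.deleteVertex u).IsUniform r := fun e he => hU e he.1

theorem ncard_deleteVertex (hV : K.vertexSet.Finite) {u : α} (hu : u ∈ K.vertexSet) :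
    (K.deleteVertex u).vertexSet.ncard + 1 = K.vertexSet.ncard :=
  Set.ncard_sdiff_singleton_add_one hu hV

theorem matchings_deleteVertex (hE : K.edgeSet.Finite) (u : α)
    (hE' : (K.deleteVertex u).edgeSet.Finite) :
    (K.deleteVertex u).matchings hE' = {M ∈ K.matchings hE | ∀ e ∈ M, u ∉ e} := by
  ext M
  rw [mem_filter, mem_matchings, mem_matchings]
  constructor
  · rintro ⟨h1, h2⟩
    exact ⟨⟨fun e he => (h1 he).1, h2⟩, fun e he => (h1 he).2⟩
  · rintro ⟨⟨h1, h2⟩, h3⟩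
    exact ⟨fun e he => ⟨h1 he, h3 e he⟩, h2⟩

/-- Let `x` be a positive vector on a supertree that satisfies the eigenvalue equations for `l`
away from the root `u`. The ratio of the matching polynomials of `K` and `K - u` at `l` is
determined by the defect at `u`. -/
theorem IsSupertree.aeval_matchingPolynomial_of_defect {r : ℕ} (hr : 2 ≤ r) (hK : K.IsSupertree r)
    {u : α} (hu : u ∈ K.vertexSet) (hnt : K.vertexSet.Nontrivial) {l g : ℝ} (hl : 0 < l)
    (x : α → ℝ) (hx : ∀ i, 0 < x i)
    (hxv : ∀ i ∈ K.vertexSet, i ≠ u → K.edgeSum x i = l * x i ^ r)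
    (hxu : K.edgeSum x u = l * g * x u ^ r) :
    0 < (matchingPolynomial r (K.deleteVertex u)).aeval l ∧
      (matchingPolynomial r K).aeval l =
        (1 - g) * l * (matchingPolynomial r (K.deleteVertex u)).aeval l := by
  have hr0 : 0 < r := by omega
  have := hK.finite.fintype
  have hE := finite_edgeSet hK.finite
  set D := hE.toFinset with hD
  have memD : ∀ {e}, e ∈ D ↔ e ∈ K.edgeSet := by simp [hD]
  set B : K.vertexSet → Set α → ℝ := fun v e =>
    if v ∈ K.vertexFinset e then (∏ j ∈ K.vertexFinset e, x j) / (l * x v ^ r) else 0 with hB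
  set s : ℝ := -(l ^ r)⁻¹ with hs
  have hsumB : ∀ v : K.vertexSet, ∑ e ∈ D, B v e = if (v : α) = u then g else 1 := by
    intro v
    have h1 : ∑ e ∈ D, B v e = K.edgeSum x v / (l * x v ^ r) := by
      rw [edgeSum_eq hE, sum_filter, sum_div]
      refine sum_congr rfl fun e _ => ?_
      simp only [hB]
      split_ifs <;> simp
    have h2 := (pow_pos (hx v) r).ne'
    rw [h1]
    split_ifs with h
    · rw [h] at h2 ⊢
      rw [hxu]
      field_simp
    · rw [hxv v v.2 h, div_self (mul_ne_zero hl.ne' h2)]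
  have hprodB : ∀ e ∈ D, ∏ v ∈ K.vertexFinset e, B v e = (l ^ r)⁻¹ := by
    intro e he
    rw [prod_congr rfl fun v hv => if_pos hv, prod_div_distrib, prod_const, prod_mul_distrib,
      prod_const, prod_pow, card_vertexFinset (memD.1 he), hK.uniform e (memD.1 he)]
    have : (∏ j ∈ K.vertexFinset e, x j) ^ r ≠ 0 :=
      (pow_pos (prod_pos fun j : K.vertexSet => fun _ => hx j) r).ne'
    field_simp
  have hcol : ∀ M : Finset (Set α), M ⊆ D →
      (-1 : ℝ) ^ #M * ∏ e ∈ M, ∏ v ∈ K.vertexFinset e, B v e = s ^ #M := by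
    intro M hM
    rw [prod_congr rfl fun e he => hprodB e (hM he), prod_const, ← mul_pow, hs, neg_one_mul]
  set P := ∑ M ∈ K.matchings hE, s ^ #M with hP
  set Q := ∑ M ∈ K.matchings hE with ∀ e ∈ M, u ∉ e, s ^ #M with hQ
  have hBpos : ∀ v e, v ∈ K.vertexFinset e → 0 < B v e := by
    intro v e h
    simp only [hB, if_pos h]
    exact div_pos (prod_pos fun j _ => hx j) (mul_pos hl (pow_pos (hx v) r))
  -- The factor of the uncovered vertices is `g` if `u` is uncovered and 1 otherwise, so the
  -- alternating sum is `P - (1 - g) * Q`.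
  have hPQ : P = (1 - g) * Q := by
    have h2 : ∀ f ∈ Fintype.piFinset (fun _ : K.vertexSet => D),
        (∀ c ∈ D, ∃ v ∈ K.vertexFinset c, f v ≠ c) → ∏ v, B v (f v) = 0 := by
      intro f hfD hf
      rw [Fintype.mem_piFinset] at hfD
      by_contra h0
      have hmem : ∀ v, v ∈ K.vertexFinset (f v) := by
        intro v
        by_contra hv
        exact h0 (prod_eq_zero (mem_univ v) (if_neg hv))
      -- Pigeonhole: if every edge is missed by one of its vertices, it is chosen at most `r - 1`
      -- times, one vertex too few in total.
      have h3 : Fintype.card K.vertexSet ≤ #D * (r - 1) := by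
        rw [← card_univ, card_eq_sum_card_fiberwise (f := f) (t := D) fun v _ => hfD v]
        refine (sum_le_card_nsmul D _ (r - 1) fun e he => ?_).trans_eq (smul_eq_mul ..)
        obtain ⟨v, hv, hve⟩ := hf e he
        have h4 : #{w | f w = e} < #(K.vertexFinset e) := by
          refine card_lt_card ((ssubset_iff_of_subset fun w hw => ?_).2 ⟨v, hv, ?_⟩)
          · rw [← (mem_filter.1 hw).2]
            exact hmem w
          · simpa using hve
        rw [card_vertexFinset (memD.1 he), hK.uniform e (memD.1 he)] at h4
        omega
      have h5 := hK.ncard_edgeSet hr0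
      rw [Set.ncard_eq_toFinset_card _ hE, ← hD, ← Nat.card_coe_set_eq,
        Nat.card_eq_fintype_card] at h5
      have h6 : #D * r = #D * (r - 1) + #D := by
        obtain ⟨q, rfl⟩ := Nat.exists_eq_add_of_le' hr0
        rw [Nat.add_sub_cancel]
        ring
      omega
    have h1 := (sum_matchings_eq_sum_colourings D D subset_rfl K.vertexFinset B).trans
      (sum_eq_zero fun f hf => h2 f (mem_filter.1 hf).1 (mem_filter.1 hf).2)
    have h3 : ∑ M ∈ K.matchings hE, s ^ #M * (if ∀ e ∈ M, u ∉ e then g else 1) = 0 := by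
      rw [← h1, matchings]
      refine sum_congr ?_ fun M hM => ?_
      · refine filter_congr fun M hM => (pairwiseDisjoint_vertexFinset_iff fun e he => ?_).symm
        exact memD.1 (mem_powerset.1 hM he)
      · rw [hcol M (mem_powerset.1 (mem_filter.1 hM).1)]
        congr 1
        simp only [hsumB]
        rw [prod_filter, prod_eq_single (⟨u, hu⟩ : K.vertexSet)]
        · simp
        · intro v _ hv
          have : (v : α) ≠ u := fun h => hv (Subtype.ext h)
          simp [this]
        · simp
    have h4 : ∑ M ∈ K.matchings hE, s ^ #M * (if ∀ e ∈ M, u ∉ e then g else 1) =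
        P - (1 - g) * Q := by
      rw [hP, hQ, sum_filter, mul_sum, ← sum_sub_distrib]
      refine sum_congr rfl fun M _ => ?_
      split_ifs <;> ring
    linarith
  have hQpos : 0 < Q := by
    obtain ⟨d, hd⟩ := hK.connected.exists_rank hu
    obtain ⟨w, hw, hwu⟩ := hnt.exists_ne u
    obtain ⟨e₀, he₀, -⟩ := hK.connected.exists_crossing_edge (· = u) hu hw rfl hwu
    -- Making `u` always choose `e₀` brings its row sum to 1. With only the edges avoiding `u`
    -- constrained, the alternating sum is then `Q`. Any edge would do as `e₀`.
    set B' : K.vertexSet → Set α → ℝ := fun v e =>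
      if (v : α) = u then (if e = e₀ then 1 else 0) else B v e with hB'
    set D' := D.filter fun e => u ∉ e with hD'
    have h1 := sum_matchings_eq_sum_colourings D D' (filter_subset _ _) K.vertexFinset B'
    have h2 : ∀ v, ∑ e ∈ D, B' v e = 1 := by
      intro v
      simp only [hB']
      split_ifs with h
      · rw [sum_ite_eq', if_pos (memD.2 he₀)]
      · rw [hsumB, if_neg h]
    choose! p hp using hd
    have hB'0 : ∀ v e, 0 ≤ B' v e := by
      intro v e
      simp only [hB', hB]
      split_ifs
      · exact zero_le_one
      · exact le_rfl
      · exact div_nonneg (prod_nonneg fun j _ => (hx j).le)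
          (mul_pos hl (pow_pos (hx v) r)).le
      · exact le_rfl
    refine lt_of_lt_of_eq ?_ (h1.symm.trans ?_)
    · refine sum_pos' (fun f _ => prod_nonneg fun v _ => hB'0 _ _)
        ⟨fun v => if (v : α) = u then e₀ else p v, mem_filter.2 ⟨?_, ?_⟩, prod_pos fun v _ => ?_⟩
      · rw [Fintype.mem_piFinset]
        intro v
        split_ifs with h
        · exact memD.2 he₀
        · exact memD.2 (hp v v.2 h).1
      · intro e he
        obtain ⟨heD, hue⟩ := mem_filter.1 he
        have hcard : 0 < #(K.vertexFinset e) := by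
          rw [card_vertexFinset (memD.1 heD), hK.uniform e (memD.1 heD)]
          exact hr0
        -- The vertex of `e` nearest to `u` chooses an edge with a still nearer vertex, hence not
        -- `e`.
        obtain ⟨v, hv, hmin⟩ := exists_min_image _ (fun v : K.vertexSet => d v) (card_pos.1 hcard)
        have hvu : (v : α) ≠ u := by
          intro h
          rw [mem_vertexFinset, h] at hv
          exact hue hv
        refine ⟨v, hv, ?_⟩
        beta_reduce
        rw [if_neg hvu]
        intro hpe
        obtain ⟨h4, h5, y, hy, hlt⟩ := hp v v.2 hvu
        have hyV := K.subset_vertexSet_of_mem_edgeSet' h4 hy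
        rw [hpe] at hy
        exact absurd (hmin ⟨y, hyV⟩ (by simpa using hy)) (not_le.2 hlt)
      · by_cases h : (v : α) = u
        · simp [hB', h]
        · simpa [hB', h] using hBpos v (p v) (by simpa using (hp v v.2 h).2.1)
    · rw [hQ, matchings]
      symm
      refine sum_congr ?_ fun M hM => ?_
      · ext M
        simp only [mem_filter, mem_powerset, hD', subset_iff]
        constructor
        · rintro ⟨⟨h3, h4⟩, h5⟩
          exact ⟨fun e he => ⟨h3 he, h5 e he⟩,
            (pairwiseDisjoint_vertexFinset_iff fun e he => memD.1 (h3 he)).2 h4⟩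
        · rintro ⟨h3, h4⟩
          exact ⟨⟨fun e he => (h3 he).1,
            (pairwiseDisjoint_vertexFinset_iff fun e he => memD.1 (h3 he).1).1 h4⟩,
            fun e he => (h3 he).2⟩
      · have hM1 := mem_powerset.1 (mem_filter.1 hM).1
        have hMD := hM1.trans (filter_subset _ _)
        rw [prod_congr rfl fun v _ => h2 v, prod_const_one, mul_one, ← hcol M hMD]
        congr 1
        refine prod_congr rfl fun e he => prod_congr rfl fun v hv => ?_
        rw [mem_vertexFinset] at hv
        simp only [hB']
        rw [if_neg]
        rintro rfl
        exact (mem_filter.1 (hM1 he)).2 hv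
  have hfin := deleteVertex_finite hK.finite u
  rw [aeval_matchingPolynomial hr0 hK.finite hK.uniform hl.ne',
    aeval_matchingPolynomial hr0 hfin (deleteVertex_isUniform hK.uniform u) hl.ne',
    matchings_deleteVertex hE u, ← hs, ← hP, ← hQ, ← ncard_deleteVertex hK.finite hu, hPQ]
  exact ⟨mul_pos (pow_pos hl _) hQpos, by ring⟩

end Matchings

end Hypergraph

/-! ### Eigenvectors of coalescences -/

namespace Hypergraph

open Finset in
/-- Perron–Frobenius for weighted uniform hypergraphs. -/
theorem exists_pos_edgeSum_eq {α : Type*} {K : Hypergraph α} {r : ℕ} (hr : 0 < r)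
    (hV : K.vertexSet.Finite) (hU : K.IsUniform r) (hne : K.edgeSet.Nonempty)
    (hcut : ∀ p : α → Prop, (∃ x ∈ K.vertexSet, p x) → (∃ y ∈ K.vertexSet, ¬ p y) →
      ∃ e ∈ K.edgeSet, (∃ a ∈ e, p a) ∧ ∃ b ∈ e, ¬ p b)
    (a : α → ℝ) (ha : ∀ i, 0 < a i) :
    ∃ l : ℝ, 0 < l ∧ ∃ x : α → ℝ, (∀ i, 0 < x i) ∧
      ∀ i ∈ K.vertexSet, K.edgeSum x i = l * a i * x i ^ r := by
  classical
  have := hV.fintype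
  have hE := finite_edgeSet hV
  have memE : ∀ {e}, e ∈ hE.toFinset ↔ e ∈ K.edgeSet := by simp
  obtain ⟨l, hl, x, hx, h⟩ := exists_pos_eigenvector hE.toFinset K.vertexFinset hr
    (fun e he => (card_vertexFinset (memE.1 he)).trans (hU e (memE.1 he)))
    (hE.toFinset_nonempty.2 hne) (fun i => a i) (fun i => ha i) (by
      rintro p ⟨y, hy⟩ ⟨z, hz⟩
      obtain ⟨e, he, ⟨b, hb, hV', hpb⟩, c, hc, hpc⟩ := hcut (fun b => ∃ h, p ⟨b, h⟩)
        ⟨y, y.2, y.2, hy⟩ ⟨z, z.2, fun ⟨_, h⟩ => hz h⟩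
      refine ⟨e, memE.2 he, ⟨⟨b, hV'⟩, mem_vertexFinset.2 hb, hpb⟩,
        ⟨c, K.subset_vertexSet_of_mem_edgeSet' he hc⟩, mem_vertexFinset.2 hc,
        fun h => hpc ⟨_, h⟩⟩)
  -- The value 1 off the vertex set only keeps the vector positive everywhere.
  refine ⟨l, hl, fun i => if h : i ∈ K.vertexSet then x ⟨i, h⟩ else 1, fun i => ?_, fun i hi => ?_⟩
  · beta_reduce
    split_ifs with h
    · exact hx _
    · exact one_pos
  · have h1 := h ⟨i, hi⟩
    rw [edgeSum_eq hE _ ⟨i, hi⟩]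
    simp only [Subtype.coe_prop, dif_pos, hi]
    exact h1

theorem edgeSum_const_mul {α : Type*} {K : Hypergraph α} {r : ℕ} (hV : K.vertexSet.Finite)
    (hU : K.IsUniform r) (c : ℝ) (x : α → ℝ) {i : α} (hi : i ∈ K.vertexSet) :
    K.edgeSum (fun j => c * x j) i = c ^ r * K.edgeSum x i := by
  classical
  have := hV.fintype
  have hE := finite_edgeSet hV
  rw [edgeSum_eq hE _ ⟨i, hi⟩, edgeSum_eq hE _ ⟨i, hi⟩, Finset.mul_sum]
  refine Finset.sum_congr rfl fun e he => ?_
  have he' : e ∈ K.edgeSet := by simpa using (Finset.mem_filter.1 he).1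
  rw [Finset.prod_mul_distrib, Finset.prod_const, card_vertexFinset he', hU e he']

section Coalescence

variable {ι α : Type*} {K : ι → Hypergraph α} {w : ι → α}

/-- The inclusion of the `i`-th branch into a coalescence. -/
noncomputable def branch (w : ι → α) (i : ι) (a : α) : Option (ι × α) := identifyRoots w (i, a)

@[simp]
theorem branch_root (i : ι) : branch w i (w i) = none := by simp [branch, identifyRoots]

theorem branch_of_ne {i : ι} {a : α} (h : a ≠ w i) : branch w i a = some (i, a) := by
  simp [branch, identifyRoots, h]

@[simp]
theorem branch_eq_none_iff {i : ι} {a : α} : branch w i a = none ↔ a = w i := by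
  simp [branch, identifyRoots]

theorem branch_eq_branch_iff {i j : ι} {a b : α} :
    branch w i a = branch w j b ↔ (i = j ∧ a = b) ∨ (a = w i ∧ b = w j) := by
  by_cases ha : a = w i
  · subst ha
    rw [branch_root, eq_comm, branch_eq_none_iff]
    constructor
    · rintro rfl
      exact Or.inr ⟨rfl, rfl⟩
    · rintro (⟨rfl, rfl⟩ | ⟨-, rfl⟩) <;> rfl
  · rw [branch_of_ne ha]
    by_cases hb : b = w j
    · subst hb
      simp only [branch_root, reduceCtorEq, ha, false_and, or_false, false_iff, not_and]
      rintro rfl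
      exact ha
    · simp [branch_of_ne hb, ha]

theorem branch_injective (i : ι) : Function.Injective (branch w i) := by
  intro a b h
  rcases branch_eq_branch_iff.1 h with ⟨-, h⟩ | ⟨h1, h2⟩
  · exact h
  · exact h1.trans h2.symm

theorem mem_vertexSet_coalescence {p : Option (ι × α)} :
    p ∈ (coalescence K w).vertexSet ↔ ∃ i, ∃ a ∈ (K i).vertexSet, branch w i a = p := by
  constructor
  · rintro ⟨⟨i, a⟩, h, rfl⟩
    exact ⟨i, a, h, rfl⟩
  · rintro ⟨i, a, h, rfl⟩
    exact ⟨(i, a), h, rfl⟩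

theorem mem_edgeSet_coalescence {f : Set (Option (ι × α))} :
    f ∈ (coalescence K w).edgeSet ↔ ∃ i, ∃ e ∈ (K i).edgeSet, branch w i '' e = f := by
  constructor
  · rintro ⟨_, ⟨i, e, he, rfl⟩, rfl⟩
    exact ⟨i, e, he, by rw [Set.image_image]; rfl⟩
  · rintro ⟨i, e, he, rfl⟩
    exact ⟨_, ⟨i, e, he, rfl⟩, by rw [Set.image_image]; rfl⟩

theorem coalescence_isUniform {r : ℕ} (hU : ∀ i, (K i).IsUniform r) :
    (coalescence K w).IsUniform r := by
  intro f hf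
  obtain ⟨i, e, he, rfl⟩ := mem_edgeSet_coalescence.1 hf
  rw [Set.ncard_image_of_injective _ (branch_injective i), hU i e he]

theorem coalescence_finite [Finite ι] (hV : ∀ i, (K i).vertexSet.Finite) :
    (coalescence K w).vertexSet.Finite := by
  have : (coalescence K w).vertexSet = ⋃ i, branch w i '' (K i).vertexSet := by
    ext p
    simp [mem_vertexSet_coalescence]
  rw [this]
  exact Set.finite_iUnion fun i => (hV i).image _

theorem coalescence_exists_crossing_edge (hK : ∀ i, (K i).IsConnected)
    (hw : ∀ i, w i ∈ (K i).vertexSet) (p : Option (ι × α) → Prop)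
    (hx : ∃ x ∈ (coalescence K w).vertexSet, p x)
    (hy : ∃ y ∈ (coalescence K w).vertexSet, ¬ p y) :
    ∃ e ∈ (coalescence K w).edgeSet, (∃ a ∈ e, p a) ∧ ∃ b ∈ e, ¬ p b := by
  have key : ∃ i, ∃ a ∈ (K i).vertexSet, ∃ b ∈ (K i).vertexSet,
      p (branch w i a) ∧ ¬ p (branch w i b) := by
    obtain ⟨x, hx, hpx⟩ := hx
    obtain ⟨y, hy, hpy⟩ := hy
    obtain ⟨i, a, ha, rfl⟩ := mem_vertexSet_coalescence.1 hx
    obtain ⟨j, b, hb, rfl⟩ := mem_vertexSet_coalescence.1 hy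
    by_cases h : p none
    · exact ⟨j, w j, hw j, b, hb, by rwa [branch_root], hpy⟩
    · exact ⟨i, a, ha, w i, hw i, hpx, by rwa [branch_root]⟩
  obtain ⟨i, a, ha, b, hb, hpa, hpb⟩ := key
  obtain ⟨e, he, ⟨c, hc, hpc⟩, d, hd, hpd⟩ :=
    (hK i).exists_crossing_edge (fun a => p (branch w i a)) ha hb hpa hpb
  exact ⟨_, mem_edgeSet_coalescence.2 ⟨i, e, he, rfl⟩, ⟨_, ⟨c, hc, rfl⟩, hpc⟩, _, ⟨d, hd, rfl⟩, hpd⟩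

theorem exists_ne_of_mem_edgeSet {r : ℕ} (hr : 2 ≤ r) {L : Hypergraph α} (hU : L.IsUniform r)
    {e : Set α} (he : e ∈ L.edgeSet) (u : α) : ∃ a ∈ e, a ≠ u :=
  Set.exists_ne_of_one_lt_ncard (by rw [hU e he]; omega) u

/-- As `r ≥ 2`, every edge has a vertex other than the root, and this vertex reveals the branch. -/
theorem branch_image_eq_iff {r : ℕ} (hr : 2 ≤ r) (hU : ∀ i, (K i).IsUniform r) {i j : ι}
    {e f : Set α} (he : e ∈ (K i).edgeSet) :
    branch w i '' e = branch w j '' f ↔ i = j ∧ e = f := by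
  constructor
  · intro h
    obtain ⟨a, ha, hne⟩ := exists_ne_of_mem_edgeSet hr (hU i) he (w i)
    have h1 : branch w i a ∈ branch w j '' f := h ▸ ⟨a, ha, rfl⟩
    obtain ⟨b, hb, hab⟩ := h1
    rcases branch_eq_branch_iff.1 hab with ⟨rfl, -⟩ | ⟨-, h2⟩
    · exact ⟨rfl, Set.image_injective.2 (branch_injective j) h⟩
    · exact absurd h2 hne
  · rintro ⟨rfl, rfl⟩
    rfl

theorem finsum_branch_images (x : Option (ι × α) → ℝ) (i : ι) (s : Set (Set α)) :
    ∑ᶠ f ∈ (branch w i '' ·) '' s, ∏ᶠ j ∈ f, x j =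
      ∑ᶠ e ∈ s, ∏ᶠ j ∈ e, x (branch w i j) := by
  rw [finsum_mem_image (Set.image_injective.2 (branch_injective i)).injOn]
  exact finsum_mem_congr rfl fun e _ => finprod_mem_image (branch_injective i).injOn

theorem edgeSum_coalescence_branch (x : Option (ι × α) → ℝ) {i : ι} {a : α} (ha : a ≠ w i) :
    (coalescence K w).edgeSum x (branch w i a) = (K i).edgeSum (fun b => x (branch w i b)) a := by
  rw [edgeSum, edgeSum, ← finsum_branch_images x i]
  refine finsum_mem_congr ?_ fun _ _ => rfl
  ext f
  constructor
  · rintro ⟨hf, hfa⟩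
    obtain ⟨j, e, he, rfl⟩ := mem_edgeSet_coalescence.1 hf
    obtain ⟨b, hb, hab⟩ := hfa
    rcases branch_eq_branch_iff.1 hab with ⟨rfl, rfl⟩ | ⟨-, h⟩
    · exact ⟨e, ⟨he, hb⟩, rfl⟩
    · exact absurd h ha
  · rintro ⟨e, ⟨he, hb⟩, rfl⟩
    exact ⟨mem_edgeSet_coalescence.2 ⟨i, e, he, rfl⟩, a, hb, rfl⟩

theorem edgeSum_coalescence_none [Fintype ι] {r : ℕ} (hr : 2 ≤ r) (hU : ∀ i, (K i).IsUniform r)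
    (hV : ∀ i, (K i).vertexSet.Finite) (x : Option (ι × α) → ℝ) :
    (coalescence K w).edgeSum x none =
      ∑ i, (K i).edgeSum (fun b => x (branch w i b)) (w i) := by
  have hset : {f | f ∈ (coalescence K w).edgeSet ∧ none ∈ f} =
      ⋃ i, (branch w i '' ·) '' {e | e ∈ (K i).edgeSet ∧ w i ∈ e} := by
    ext f
    simp only [Set.mem_iUnion]
    constructor
    · rintro ⟨hf, hfa⟩
      obtain ⟨j, e, he, rfl⟩ := mem_edgeSet_coalescence.1 hf
      obtain ⟨b, hb, hab⟩ := hfa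
      rw [branch_eq_none_iff] at hab
      subst hab
      exact ⟨j, e, ⟨he, hb⟩, rfl⟩
    · rintro ⟨i, e, ⟨he, hb⟩, rfl⟩
      exact ⟨mem_edgeSet_coalescence.2 ⟨i, e, he, rfl⟩, w i, hb, branch_root i⟩
  rw [edgeSum, hset, finsum_mem_iUnion, finsum_eq_sum_of_fintype]
  · exact Finset.sum_congr rfl fun i _ => finsum_branch_images x i _
  · intro i j hij
    refine Set.disjoint_left.2 ?_
    rintro _ ⟨e, ⟨he, -⟩, rfl⟩ ⟨f, -, h⟩
    exact hij ((branch_image_eq_iff hr hU he).1 h.symm).1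
  · exact fun i => ((finite_edgeSet (hV i)).subset fun e he => he.1).image _

/-- A positive vector with entry `1` at the root `u` that satisfies the eigenvalue equations for
`l` away from `u`; at `u` the edge sum is `l * g`. -/
structure IsRootedVector (L : Hypergraph α) (r : ℕ) (u : α) (l g : ℝ) (x : α → ℝ) : Prop where
  pos : ∀ i, 0 < x i
  root : x u = 1
  edgeSum_eq : ∀ i ∈ L.vertexSet, i ≠ u → L.edgeSum x i = l * x i ^ r
  edgeSum_root : L.edgeSum x u = l * g

/-- The vectors agree at the root, so they glue. Only the equation at the root involves several
branches, and there it reads `∑ i, g i = 1`. Allowing `l = 0` covers branches without edges. -/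
theorem isSpectralRadius_coalescence [Fintype ι] [Nonempty ι] {r : ℕ} (hr : 2 ≤ r)
    (hU : ∀ i, (K i).IsUniform r) (hV : ∀ i, (K i).vertexSet.Finite)
    (hw : ∀ i, w i ∈ (K i).vertexSet) {l : ℝ} (hl : 0 ≤ l) {g : ι → ℝ} {x : ι → α → ℝ}
    (hx : ∀ i, (K i).IsRootedVector r (w i) l (g i) (x i)) (hg : ∑ i, g i = 1) :
    IsSpectralRadius r (coalescence K w) l := by
  set X : Option (ι × α) → ℝ := fun p => p.elim 1 fun q => x q.1 q.2 with hX
  have hXb : ∀ i b, X (branch w i b) = x i b := by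
    intro i b
    by_cases h : b = w i
    · subst h
      rw [branch_root, (hx i).root]
      rfl
    · rw [branch_of_ne h]
      rfl
  refine isSpectralRadius_of_pos (by omega) (coalescence_finite hV) ?_ (coalescence_isUniform hU)
    hl X ?_ ?_
  · obtain ⟨i⟩ := ‹Nonempty ι›
    exact ⟨_, mem_vertexSet_coalescence.2 ⟨i, w i, hw i, rfl⟩⟩
  · rintro (_ | ⟨i, a⟩)
    · exact one_pos
    · exact (hx i).pos a
  · intro p hp
    obtain ⟨i, a, ha, rfl⟩ := mem_vertexSet_coalescence.1 hp
    by_cases h : a = w i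
    · subst h
      simp only [branch_root]
      rw [edgeSum_coalescence_none hr hU hV]
      simp only [hXb, (hx _).edgeSum_root, ← Finset.mul_sum, hg]
      simp [hX]
    · rw [edgeSum_coalescence_branch X h]
      simp only [hXb]
      exact (hx i).edgeSum_eq a ha h

end Coalescence

/-- Two rooted supertrees with the same matching polynomials admit rooted vectors for a common
eigenvalue and a prescribed defect. -/
theorem exists_isRootedVector {α : Type*} {r : ℕ} (hr : 2 ≤ r) {G H : Hypergraph α}
    (hG : G.IsSupertree r) (hH : H.IsSupertree r) {u v : α} (hu : u ∈ G.vertexSet)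
    (hv : v ∈ H.vertexSet) (hGn : G.vertexSet.Nontrivial) (hHn : H.vertexSet.Nontrivial)
    (hφ : matchingPolynomial r G = matchingPolynomial r H)
    (hφ' : matchingPolynomial r (G.deleteVertex u) = matchingPolynomial r (H.deleteVertex v))
    {g : ℝ} (hg : 0 < g) :
    ∃ l : ℝ, 0 < l ∧ (∃ x, G.IsRootedVector r u l g x) ∧ ∃ y, H.IsRootedVector r v l g y := by
  classical
  set K : Bool → Hypergraph α := fun b => cond b G H with hK
  set w : Bool → α := fun b => cond b u v with hw
  have hT : ∀ b, (K b).IsSupertree r := by rintro (_ | _) <;> assumption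
  have hwK : ∀ b, w b ∈ (K b).vertexSet := by rintro (_ | _) <;> assumption
  have hnt : ∀ b, (K b).vertexSet.Nontrivial := by rintro (_ | _) <;> assumption
  have hne : (coalescence K w).edgeSet.Nonempty := by
    obtain ⟨a, ha, hau⟩ := hGn.exists_ne u
    obtain ⟨e, he, -⟩ := hG.connected.exists_crossing_edge (· = u) hu ha rfl hau
    exact ⟨_, mem_edgeSet_coalescence.2 ⟨true, e, he, rfl⟩⟩
  -- The root weight is `2 * g` because two branches share the root and each is to receive `g`.
  obtain ⟨l, hl, X, hX, hXeq⟩ := exists_pos_edgeSum_eq (K := coalescence K w) (r := r) (by omega)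
    (coalescence_finite fun b => (hT b).finite) (coalescence_isUniform fun b => (hT b).uniform) hne
    (coalescence_exists_crossing_edge (fun b => (hT b).connected) hwK)
    (fun p => if p = none then 2 * g else 1) (fun p => by
      split_ifs <;> positivity)
  set c := (X none)⁻¹ with hc
  have hcpos : 0 < c := inv_pos.2 (hX none)
  set x : Bool → α → ℝ := fun b a => c * X (branch w b a) with hx
  have hscale : ∀ b, ∀ a ∈ (K b).vertexSet,
      (K b).edgeSum (x b) a = c ^ r * (K b).edgeSum (fun a => X (branch w b a)) a :=
    fun b a ha => edgeSum_const_mul (hT b).finite (hT b).uniform c _ ha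
  set d : Bool → ℝ := fun b => (K b).edgeSum (x b) (w b) / l with hd
  have hrv : ∀ b, (K b).IsRootedVector r (w b) l (d b) (x b) := by
    intro b
    refine ⟨fun a => mul_pos hcpos (hX _), ?_, fun a ha hne => ?_, ?_⟩
    · simp only [hx, branch_root]
      exact inv_mul_cancel₀ (hX none).ne'
    · have h1 := hXeq _ (mem_vertexSet_coalescence.2 ⟨b, a, ha, rfl⟩)
      rw [edgeSum_coalescence_branch X hne, if_neg (by rwa [branch_eq_none_iff])] at h1
      rw [hscale b a ha, h1]
      simp only [hx]
      ring
    · rw [hd]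
      field_simp
  have hsum : d true + d false = 2 * g := by
    have h1 := hXeq none (mem_vertexSet_coalescence.2 ⟨true, w true, hwK true, branch_root true⟩)
    rw [edgeSum_coalescence_none hr (fun b => (hT b).uniform) (fun b => (hT b).finite),
      Fintype.sum_bool, if_pos rfl] at h1
    have h2 : c ^ r * X none ^ r = 1 := by
      rw [← mul_pow, hc, inv_mul_cancel₀ (hX none).ne', one_pow]
    simp only [hd]
    rw [hscale _ _ (hwK true), hscale _ _ (hwK false), ← add_div, ← mul_add, h1]
    rw [div_eq_iff hl.ne']
    linear_combination (2 * g * l) * h2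
  have hpoly : ∀ b, 0 < (matchingPolynomial r ((K b).deleteVertex (w b))).aeval l ∧
      (matchingPolynomial r (K b)).aeval l =
        (1 - d b) * l * (matchingPolynomial r ((K b).deleteVertex (w b))).aeval l := by
    intro b
    have h := hrv b
    refine (hT b).aeval_matchingPolynomial_of_defect hr (hwK b) (hnt b) hl (x b) h.pos
      h.edgeSum_eq ?_
    rw [h.edgeSum_root, h.root]
    ring
  obtain ⟨hQ, hPG⟩ := hpoly true
  obtain ⟨-, hPH⟩ := hpoly false
  simp only [hK, hw, cond_true, cond_false] at hQ hPG hPH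
  rw [← hφ, ← hφ', hPG] at hPH
  -- Equal polynomials force `1 - d true = 1 - d false`; the values cancelled are nonzero.
  have h1 := mul_right_cancel₀ hl.ne' (mul_right_cancel₀ hQ.ne' hPH)
  have h2 : d true = g := by linarith
  have h3 : d false = g := by linarith
  exact ⟨l, hl, ⟨_, h2 ▸ hrv true⟩, ⟨_, h3 ▸ hrv false⟩⟩

end Hypergraph

/-! ### Matchings of coalescences -/

/-- Finite types whose fibres over `B` have the same cardinalities are equivalent over `B`. -/
theorem exists_equiv_of_card_fiber_eq {A A' B : Type*} [Finite A] [Finite A'] (f : A → B)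
    (f' : A' → B) (h : ∀ b, Nat.card {a // f a = b} = Nat.card {a // f' a = b}) :
    ∃ σ : A ≃ A', ∀ a, f' (σ a) = f a := by
  have he : ∀ b, Nonempty ({a // f a = b} ≃ {a // f' a = b}) := fun b =>
    ⟨(Finite.equivFinOfCardEq (h b)).trans (Finite.equivFinOfCardEq rfl).symm⟩
  exact ⟨(Equiv.sigmaFiberEquiv f).symm.trans ((Equiv.sigmaCongrRight fun b => (he b).some).trans
    (Equiv.sigmaFiberEquiv f')), fun a => ((he (f a)).some ⟨a, rfl⟩).2⟩

theorem Nat.card_subtype_coe_finset {A : Type*} (s : Finset A) (p : A → Prop) [DecidablePred p] :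
    Nat.card {a : s // p a} = (s.filter p).card := by
  rw [← Nat.card_eq_finsetCard]
  exact Nat.card_congr ⟨fun a => ⟨a.1.1, Finset.mem_filter.2 ⟨a.1.2, a.2⟩⟩,
    fun a => ⟨⟨a.1, (Finset.mem_filter.1 a.2).1⟩, (Finset.mem_filter.1 a.2).2⟩,
    fun _ => rfl, fun _ => rfl⟩

namespace Hypergraph

open Finset
open scoped Classical

section

variable {α : Type*} {K L : Hypergraph α}

theorem coeff_matchingPolynomial {r : ℕ} (hr : 0 < r) {k : ℕ} (hk : k * r ≤ K.vertexSet.ncard) :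
    (matchingPolynomial r K).coeff (K.vertexSet.ncard - k * r) =
      (-1 : ℤ) ^ k * (K.matchingCount k : ℤ) := by
  simp only [matchingPolynomial, Polynomial.finsetSum_coeff, Polynomial.coeff_monomial]
  rw [sum_eq_single k, if_pos rfl]
  · intro j hj hjk
    have hj' : j * r ≤ K.vertexSet.ncard :=
      (Nat.le_div_iff_mul_le hr).1 (Nat.lt_succ_iff.1 (mem_range.1 hj))
    refine if_neg fun h => hjk (Nat.eq_of_mul_eq_mul_right hr ?_)
    omega
  · intro h
    rw [mem_range, Nat.lt_succ_iff, Nat.le_div_iff_mul_le hr] at h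
    exact absurd hk h

theorem matchingCount_eq_zero {r : ℕ} (hV : K.vertexSet.Finite) (hU : K.IsUniform r) {k : ℕ}
    (hk : K.vertexSet.ncard < k * r) : K.matchingCount k = 0 := by
  rw [matchingCount_eq (finite_edgeSet hV), card_eq_zero, filter_eq_empty_iff]
  rintro M hM rfl
  exact absurd (card_mul_le_of_mem_matchings hV hU hM) (not_le.2 hk)

/-- The exponents `n - k * r` with `k * r ≤ n` are distinct, so each count is a coefficient up to
sign; larger matchings do not exist. -/
theorem matchingCount_eq_of_matchingPolynomial_eq {r : ℕ} (hr : 0 < r) (hK : K.vertexSet.Finite)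
    (hL : L.vertexSet.Finite) (hKU : K.IsUniform r) (hLU : L.IsUniform r)
    (hcard : K.vertexSet.ncard = L.vertexSet.ncard)
    (h : matchingPolynomial r K = matchingPolynomial r L) (k : ℕ) :
    K.matchingCount k = L.matchingCount k := by
  by_cases hk : k * r ≤ K.vertexSet.ncard
  · have h1 := coeff_matchingPolynomial hr hk
    rw [h, hcard, coeff_matchingPolynomial hr (hcard ▸ hk)] at h1
    exact_mod_cast (mul_left_cancel₀ (pow_ne_zero k (by norm_num)) h1).symm
  · rw [matchingCount_eq_zero hK hKU (not_le.1 hk),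
      matchingCount_eq_zero hL hLU (hcard ▸ not_le.1 hk)]

/-- Some edge in `M` contains `u`. -/
def Covers (M : Finset (Set α)) (u : α) : Prop := ∃ e ∈ M, u ∈ e

theorem card_matchings_not_covers (hE : K.edgeSet.Finite) (u : α) (k : ℕ) :
    #{M ∈ K.matchings hE | #M = k ∧ ¬ Covers M u} = (K.deleteVertex u).matchingCount k := by
  have hE' : (K.deleteVertex u).edgeSet.Finite := hE.subset fun e he => he.1
  rw [matchingCount_eq hE', matchings_deleteVertex hE, filter_filter]
  congr 1
  refine filter_congr fun M _ => ?_
  rw [and_comm]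
  simp [Covers]

theorem card_matchings_covers (hE : K.edgeSet.Finite) (u : α) (k : ℕ) :
    #{M ∈ K.matchings hE | #M = k ∧ Covers M u} + (K.deleteVertex u).matchingCount k =
      K.matchingCount k := by
  rw [← card_matchings_not_covers hE, matchingCount_eq hE, ← filter_filter, ← filter_filter]
  exact card_filter_add_card_filter_not _

/-- If the matching counts of `K` and `L`, and of `K - u` and `L - v`, agree, then there is a
bijection between the matchings of `K` and `L` that respects their sizes and whether they cover
the roots. -/
theorem exists_equiv_matchings (hK : K.edgeSet.Finite) (hL : L.edgeSet.Finite) {u v : α}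
    (h : ∀ k, K.matchingCount k = L.matchingCount k)
    (h' : ∀ k, (K.deleteVertex u).matchingCount k = (L.deleteVertex v).matchingCount k) :
    ∃ σ : K.matchings hK ≃ L.matchings hL, ∀ M, #(σ M : Finset (Set α)) = #(M : Finset (Set α)) ∧
      (Covers (σ M : Finset (Set α)) v ↔ Covers (M : Finset (Set α)) u) := by
  obtain ⟨σ, hσ⟩ := exists_equiv_of_card_fiber_eq
    (fun M : K.matchings hK => (#(M : Finset (Set α)), Covers (M : Finset (Set α)) u))
    (fun M : L.matchings hL => (#(M : Finset (Set α)), Covers (M : Finset (Set α)) v)) (by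
      rintro ⟨k, p⟩
      simp only [Prod.mk.injEq]
      rw [Nat.card_subtype_coe_finset _ fun M => #M = k ∧ Covers M u = p,
        Nat.card_subtype_coe_finset _ fun M => #M = k ∧ Covers M v = p]
      -- The second coordinate is a proposition, so its fibres are "covers" and "does not cover";
      -- the former is counted as a difference.
      by_cases hp : p
      · have h1 := card_matchings_covers hK u k
        have h2 := card_matchings_covers hL v k
        rw [h, h'] at h1
        simp only [hp, eq_iff_iff, iff_true]
        omega
      · simp only [hp, eq_iff_iff, iff_false]
        rw [card_matchings_not_covers, card_matchings_not_covers, h'])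
  exact ⟨σ, fun M => ⟨congrArg Prod.fst (hσ M), iff_of_eq (congrArg Prod.snd (hσ M))⟩⟩

end

section Coalescence

variable {ι α : Type*} [Fintype ι] {K : ι → Hypergraph α} {w : ι → α}

/-- At most one of the sets `f i` of edges covers its root. -/
def AtMostOneCovers (w : ι → α) (f : ι → Finset (Set α)) : Prop :=
  ∀ i j, i ≠ j → Covers (f i) (w i) → ¬ Covers (f j) (w j)

/-- The edges of a coalescence that come from a family of sets of edges of the branches. -/
noncomputable def unionBranches (w : ι → α) (f : ι → Finset (Set α)) :
    Finset (Set (Option (ι × α))) :=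
  univ.biUnion fun i => (f i).image (branch w i '' ·)

theorem mem_unionBranches {f : ι → Finset (Set α)} {s : Set (Option (ι × α))} :
    s ∈ unionBranches w f ↔ ∃ i, ∃ e ∈ f i, branch w i '' e = s := by
  simp [unionBranches]

theorem branch_image_mem_unionBranches {r : ℕ} (hr : 2 ≤ r) (hU : ∀ i, (K i).IsUniform r)
    {f : ι → Finset (Set α)} (hf : ∀ i, (f i : Set (Set α)) ⊆ (K i).edgeSet) {i : ι} {e : Set α} :
    branch w i '' e ∈ unionBranches w f ↔ e ∈ f i := by
  rw [mem_unionBranches]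
  constructor
  · rintro ⟨j, e', he', h⟩
    obtain ⟨rfl, rfl⟩ := (branch_image_eq_iff hr hU (hf j he')).1 h
    exact he'
  · exact fun he => ⟨i, e, he, rfl⟩

theorem card_unionBranches {r : ℕ} (hr : 2 ≤ r) (hU : ∀ i, (K i).IsUniform r)
    {f : ι → Finset (Set α)} (hf : ∀ i, (f i : Set (Set α)) ⊆ (K i).edgeSet) :
    #(unionBranches w f) = ∑ i, #(f i) := by
  rw [unionBranches, card_biUnion]
  · exact sum_congr rfl fun i _ =>
      card_image_of_injective _ (Set.image_injective.2 (branch_injective i))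
  · intro i _ j _ hij
    refine disjoint_left.2 fun s hs hs' => ?_
    obtain ⟨e, he, rfl⟩ := mem_image.1 hs
    obtain ⟨e', -, h⟩ := mem_image.1 hs'
    exact hij ((branch_image_eq_iff hr hU (hf i he)).1 h.symm).1

theorem unionBranches_mem_matchings (hE : ∀ i, (K i).edgeSet.Finite)
    (hE' : (coalescence K w).edgeSet.Finite) {f : ι → Finset (Set α)}
    (hf : ∀ i, f i ∈ (K i).matchings (hE i)) (hw : AtMostOneCovers w f) :
    unionBranches w f ∈ (coalescence K w).matchings hE' := by
  rw [mem_matchings]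
  constructor
  · intro s hs
    obtain ⟨i, e, he, rfl⟩ := mem_unionBranches.1 hs
    exact mem_edgeSet_coalescence.2 ⟨i, e, (mem_matchings.1 (hf i)).1 he, rfl⟩
  · intro s hs t ht hst
    obtain ⟨i, e, he, rfl⟩ := mem_unionBranches.1 hs
    obtain ⟨j, e', he', rfl⟩ := mem_unionBranches.1 ht
    refine Set.disjoint_left.2 ?_
    rintro _ ⟨a, ha, rfl⟩ ⟨b, hb, hab⟩
    rcases branch_eq_branch_iff.1 hab with ⟨rfl, rfl⟩ | ⟨rfl, rfl⟩
    · have hne : e ≠ e' := fun h => hst (by rw [h])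
      exact Set.disjoint_left.1 ((mem_matchings.1 (hf j)).2 he he' hne) ha hb
    · by_cases hij : i = j
      · subst hij
        have hne : e ≠ e' := fun h => hst (by rw [h])
        exact Set.disjoint_left.1 ((mem_matchings.1 (hf i)).2 he he' hne) ha hb
      · exact hw i j hij ⟨e, he, ha⟩ ⟨e', he', hb⟩

theorem exists_unionBranches_eq (hE : ∀ i, (K i).edgeSet.Finite)
    (hE' : (coalescence K w).edgeSet.Finite) {M : Finset (Set (Option (ι × α)))}
    (hM : M ∈ (coalescence K w).matchings hE') {r : ℕ} (hr : 2 ≤ r)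
    (hU : ∀ i, (K i).IsUniform r) :
    ∃ f : ι → Finset (Set α), (∀ i, f i ∈ (K i).matchings (hE i)) ∧ AtMostOneCovers w f ∧
      unionBranches w f = M := by
  obtain ⟨hM1, hM2⟩ := mem_matchings.1 hM
  refine ⟨fun i => {e ∈ (hE i).toFinset | branch w i '' e ∈ M}, fun i => ?_, ?_, ?_⟩
  · refine mem_matchings.2 ⟨fun e he => by simpa using (mem_filter.1 he).1, ?_⟩
    intro e he e' he' hne
    have h := hM2 (mem_filter.1 he).2 (mem_filter.1 he').2
      ((Set.image_injective.2 (branch_injective i)).ne hne)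
    exact h.of_image
  · rintro i j hij ⟨e, he, hwe⟩ ⟨e', he', hwe'⟩
    have hei : e ∈ (K i).edgeSet := by simpa using (mem_filter.1 he).1
    have h := hM2 (mem_filter.1 he).2 (mem_filter.1 he').2
      fun h => hij ((branch_image_eq_iff hr hU hei).1 h).1
    exact Set.disjoint_left.1 h ⟨_, hwe, branch_root i⟩ ⟨_, hwe', branch_root j⟩
  · ext s
    rw [mem_unionBranches]
    constructor
    · rintro ⟨i, e, he, rfl⟩
      exact (mem_filter.1 he).2
    · intro hs
      obtain ⟨i, e, he, rfl⟩ := mem_edgeSet_coalescence.1 (hM1 hs)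
      exact ⟨i, e, mem_filter.2 ⟨by simpa using he, hs⟩, rfl⟩

/-- Edges from different branches can meet only at the glued vertex, so disjointness across branches
means that at most one branch covers its root. -/
theorem matchingCount_coalescence {r : ℕ} (hr : 2 ≤ r) (hU : ∀ i, (K i).IsUniform r)
    (hE : ∀ i, (K i).edgeSet.Finite) (hE' : (coalescence K w).edgeSet.Finite) (k : ℕ) :
    (coalescence K w).matchingCount k =
      Nat.card {f : ∀ i, (K i).matchings (hE i) //
        AtMostOneCovers w (fun i => (f i : Finset (Set α))) ∧
          ∑ i, #(f i : Finset (Set α)) = k} := by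
  rw [matchingCount_eq hE', ← Nat.card_eq_finsetCard]
  have hsub : ∀ (f : ∀ i, (K i).matchings (hE i)) (i : ι),
      ((f i : Finset (Set α)) : Set (Set α)) ⊆ (K i).edgeSet :=
    fun f i => (mem_matchings.1 (f i).2).1
  have hmem : ∀ f : {f : ∀ i, (K i).matchings (hE i) //
      AtMostOneCovers w (fun i => (f i : Finset (Set α))) ∧ ∑ i, #(f i : Finset (Set α)) = k},
      unionBranches w (fun i => (f.1 i).1) ∈ {M ∈ (coalescence K w).matchings hE' | #M = k} :=
    fun f => mem_filter.2 ⟨unionBranches_mem_matchings hE hE' (fun i => (f.1 i).2) f.2.1,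
      (card_unionBranches hr hU (hsub f.1)).trans f.2.2⟩
  refine (Nat.card_congr (Equiv.ofBijective (fun f => ⟨_, hmem f⟩) ⟨?_, ?_⟩)).symm
  · rintro ⟨f, hf⟩ ⟨g, hg⟩ h
    have h1 : unionBranches w (fun i => (f i).1) = unionBranches w fun i => (g i).1 :=
      congrArg Subtype.val h
    refine Subtype.ext (funext fun i => Subtype.ext (Finset.ext fun e => ?_))
    change e ∈ (f i).1 ↔ e ∈ (g i).1
    rw [← branch_image_mem_unionBranches (w := w) hr hU (hsub f), h1,
      branch_image_mem_unionBranches hr hU (hsub g)]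
  · rintro ⟨M, hM⟩
    obtain ⟨hM1, hM2⟩ := mem_filter.1 hM
    obtain ⟨f, hf, hw, rfl⟩ := exists_unionBranches_eq hE hE' hM1 hr hU
    refine ⟨⟨fun i => ⟨f i, hf i⟩, hw, ?_⟩, rfl⟩
    rw [← hM2, card_unionBranches hr hU (hsub fun i => ⟨f i, hf i⟩)]

/-- The admissible families depend only on sizes and root coverage, which the branchwise bijections
preserve. -/
theorem matchingCount_coalescence_congr {K' : ι → Hypergraph α} {w' : ι → α} {r : ℕ} (hr : 2 ≤ r)
    (hU : ∀ i, (K i).IsUniform r) (hU' : ∀ i, (K' i).IsUniform r)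
    (hV : ∀ i, (K i).vertexSet.Finite) (hV' : ∀ i, (K' i).vertexSet.Finite)
    (h : ∀ i k, (K i).matchingCount k = (K' i).matchingCount k)
    (hd : ∀ i k, ((K i).deleteVertex (w i)).matchingCount k =
      ((K' i).deleteVertex (w' i)).matchingCount k) (k : ℕ) :
    (coalescence K w).matchingCount k = (coalescence K' w').matchingCount k := by
  have hE := fun i => finite_edgeSet (hV i)
  have hE' := fun i => finite_edgeSet (hV' i)
  rw [matchingCount_coalescence hr hU hE (finite_edgeSet (coalescence_finite hV)),
    matchingCount_coalescence hr hU' hE' (finite_edgeSet (coalescence_finite hV'))]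
  choose σ hσ hσc using fun i => exists_equiv_matchings (hE i) (hE' i) (h i) (hd i)
  refine Nat.card_congr ((Equiv.piCongrRight σ).subtypeEquiv fun f => ?_)
  simp only [AtMostOneCovers, Equiv.piCongrRight_apply, Pi.map_apply, hσ, hσc]

theorem ncard_vertexSet_coalescence [Nonempty ι] (hV : ∀ i, (K i).vertexSet.Finite)
    (hw : ∀ i, w i ∈ (K i).vertexSet) :
    (coalescence K w).vertexSet.ncard = ∑ i, ((K i).vertexSet.ncard - 1) + 1 := by
  have hnone : none ∈ (coalescence K w).vertexSet :=
    mem_vertexSet_coalescence.2 ⟨Classical.arbitrary ι, _, hw _, branch_root _⟩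
  rw [← Set.ncard_sdiff_singleton_add_one hnone (coalescence_finite hV)]
  have hfin : ∀ i, Finite ↥((K i).vertexSet \ {w i}) :=
    fun i => ((hV i).subset Set.sdiff_subset).to_subtype
  have h1 : Nat.card (Σ i, ↥((K i).vertexSet \ {w i})) =
      Nat.card ↥((coalescence K w).vertexSet \ {none}) := by
    refine Nat.card_congr (Equiv.ofBijective (fun p => ⟨branch w p.1 p.2,
      mem_vertexSet_coalescence.2 ⟨p.1, p.2, p.2.2.1, rfl⟩, fun h => p.2.2.2 ?_⟩) ⟨?_, ?_⟩)
    · exact branch_eq_none_iff.1 h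
    · rintro ⟨i, a, ha⟩ ⟨j, b, hb⟩ h
      rcases branch_eq_branch_iff.1 (congrArg Subtype.val h) with ⟨rfl, h2⟩ | ⟨h2, -⟩
      · obtain rfl : a = b := h2
        rfl
      · exact absurd h2 ha.2
    · rintro ⟨p, hp, hpn⟩
      obtain ⟨i, a, ha, rfl⟩ := mem_vertexSet_coalescence.1 hp
      exact ⟨⟨i, a, ha, fun h => hpn (branch_eq_none_iff.2 h)⟩, rfl⟩
  rw [← Nat.card_coe_set_eq, ← h1, Nat.card_sigma]
  congr 1
  exact sum_congr rfl fun i _ => by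
    rw [Nat.card_coe_set_eq, Set.ncard_sdiff_singleton_of_mem (hw i)]

end Coalescence

theorem IsSupertree.edgeSet_eq_empty {α : Type*} {K : Hypergraph α} {r : ℕ} (hr : 2 ≤ r)
    (hK : K.IsSupertree r) (h : ¬ K.vertexSet.Nontrivial) : K.edgeSet = ∅ := by
  rw [Set.not_nontrivial_iff] at h
  refine Set.eq_empty_of_forall_notMem fun e he => ?_
  obtain ⟨u, hu⟩ := hK.connected.1
  obtain ⟨a, ha, hne⟩ := exists_ne_of_mem_edgeSet hr hK.uniform he u
  exact hne (h (K.subset_vertexSet_of_mem_edgeSet' he ha) hu)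

end Hypergraph

/-! ### The theorem -/

theorem theorem3p3 {α : Type*} (r : ℕ) (hr : 3 ≤ r) (G H : Hypergraph α)
    (hG : G.IsSupertree r) (hH : H.IsSupertree r)
    (hcard : G.vertexSet.ncard = H.vertexSet.ncard)
    (u v : α) (hu : u ∈ G.vertexSet) (hv : v ∈ H.vertexSet)
    (m : ℕ) (hm : 1 ≤ m)
    (hφ : Hypergraph.matchingPolynomial r G = Hypergraph.matchingPolynomial r H)
    (hφ' : Hypergraph.matchingPolynomial r (G.deleteVertex u) =
      Hypergraph.matchingPolynomial r (H.deleteVertex v)) :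
    (∃ ρ : ℝ, ∀ k ≤ m,
      Hypergraph.IsSpectralRadius r (Hypergraph.mixedPower G u H v m k) ρ) ∧
    (∀ k ≤ m, Hypergraph.matchingEnergy r (Hypergraph.mixedPower G u H v m k) =
      Hypergraph.matchingEnergy r (Hypergraph.mixedPower G u H v m 0)) := by
  have hr2 : 2 ≤ r := by omega
  have : Nonempty (Fin m) := ⟨⟨0, hm⟩⟩
  have hT : ∀ (k : ℕ) (i : Fin m), (if i.val < k then G else H).IsSupertree r := by
    intro k i
    split_ifs <;> assumption
  have hw : ∀ (k : ℕ) (i : Fin m),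
      (if i.val < k then u else v) ∈ (if i.val < k then G else H).vertexSet := by
    intro k i
    split_ifs <;> assumption
  have hntGH : H.vertexSet.Nontrivial ↔ G.vertexSet.Nontrivial := by
    have := hG.finite.to_subtype
    have := hH.finite.to_subtype
    rw [← Set.one_lt_ncard_iff_nontrivial, ← hcard, Set.one_lt_ncard_iff_nontrivial]
  constructor
  · by_cases hnt : G.vertexSet.Nontrivial
    · have hntH := hntGH.2 hnt
      -- With defect `1 / m` on every branch, any mixture of `m` branches has total defect 1.
      obtain ⟨l, hl, ⟨x, hx⟩, y, hy⟩ := Hypergraph.exists_isRootedVector hr2 hG hH hu hv hnt hntH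
        hφ hφ' (g := 1 / m) (by positivity)
      refine ⟨l, fun k _ => Hypergraph.isSpectralRadius_coalescence hr2
        (fun i => (hT k i).uniform) (fun i => (hT k i).finite) (hw k) hl.le (g := fun _ => 1 / m)
        (x := fun i => if i.val < k then x else y) (fun i => ?_) ?_⟩
      · split_ifs <;> assumption
      · have : (m : ℝ) ≠ 0 := by positivity
        simp [this]
    · have hntH := hntGH.not.2 hnt
      -- Single-vertex supertrees have no edges: all edge sums vanish, and the constant vector 1 has
      -- eigenvalue 0.
      refine ⟨0, fun k _ => Hypergraph.isSpectralRadius_coalescence hr2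
        (fun i => (hT k i).uniform) (fun i => (hT k i).finite) (hw k) le_rfl (g := fun _ => 1 / m)
        (x := fun _ _ => 1) (fun i => ?_) ?_⟩
      · have hE : (if i.val < k then G else H).edgeSet = ∅ :=
          (hT k i).edgeSet_eq_empty hr2 (by split_ifs <;> assumption)
        refine ⟨fun _ => one_pos, rfl, fun a _ _ => ?_, ?_⟩ <;>
          simp [Hypergraph.edgeSum, hE]
      · have : (m : ℝ) ≠ 0 := by positivity
        simp [this]
  · intro k _
    have hcount := Hypergraph.matchingCount_eq_of_matchingPolynomial_eq (by omega) hG.finite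
      hH.finite hG.uniform hH.uniform hcard hφ
    have hcount' := Hypergraph.matchingCount_eq_of_matchingPolynomial_eq (by omega)
      (Hypergraph.deleteVertex_finite hG.finite u) (Hypergraph.deleteVertex_finite hH.finite v)
      (Hypergraph.deleteVertex_isUniform hG.uniform u)
      (Hypergraph.deleteVertex_isUniform hH.uniform v) (by
        have h1 := Hypergraph.ncard_deleteVertex hG.finite hu
        have h2 := Hypergraph.ncard_deleteVertex hH.finite hv
        omega) hφ'
    have hM : ∀ j, (Hypergraph.mixedPower G u H v m k).matchingCount j =
        (Hypergraph.mixedPower G u H v m 0).matchingCount j :=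
      Hypergraph.matchingCount_coalescence_congr hr2 (fun i => (hT k i).uniform)
        (fun i => (hT 0 i).uniform) (fun i => (hT k i).finite) (fun i => (hT 0 i).finite)
        (fun i j => by
          simp only [not_lt_zero, if_false]
          split_ifs
          · exact hcount j
          · rfl)
        (fun i j => by
          simp only [not_lt_zero, if_false]
          split_ifs
          · exact hcount' j
          · rfl)
    have hV : (Hypergraph.mixedPower G u H v m k).vertexSet.ncard =
        (Hypergraph.mixedPower G u H v m 0).vertexSet.ncard := by
      rw [Hypergraph.mixedPower, Hypergraph.mixedPower,
        Hypergraph.ncard_vertexSet_coalescence (fun i => (hT k i).finite) (hw k),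
        Hypergraph.ncard_vertexSet_coalescence (fun i => (hT 0 i).finite) (hw 0)]
      congr 1
      refine Finset.sum_congr rfl fun i _ => ?_
      simp only [not_lt_zero, if_false]
      split_ifs
      · rw [hcard]
      · rfl
    simp only [Hypergraph.matchingEnergy, Hypergraph.matchingPolynomial, hM, hV]
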